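/- Let $d\ge 0$ be an integer and $m\ge 0$, and write $\langle x\rangle=(1+|x|^2)^{1/2}$. Call $A\in C^\infty(\mathbb R^d;\mathbb R^d)$ *tempered* if there is $\tau\ge0$ such that for every multi-index $\beta$ there is a constant $C_\beta$ with $|\partial^\beta A(x)|\le C_\beta\langle x\rangle^{\tau}$ for all $x\in\mathbb R^d$. The oscillatory integral $\mathrm{Os}\text{-}\!\iint e^{-iy\cdot\eta}a(\eta,y)\,dy\,d\eta$ is the limit as $\varepsilon\to0+$ of the absolutely convergent integrals $\iint e^{-iy\cdot\eta}\chi(\varepsilon\eta,\varepsilon y)a(\eta,y)\,dy\,d\eta$, provided that these integrals converge absolutely and the limit exists for every $\chi\in\mathcal S(\mathbb R^d\times\mathbb R^d)$ with $\chi(0,0)=1$, and does not depend on $\chi$. For tempered $A$, $f\in C_0^\infty(\mathbb R^d)$ and $x\in\mathbb R^d$ put $$(H_A^{(1)}f)(x)=\frac1{(2\pi)^d}\,\mathrm{Os}\text{-}\!\iint e^{i(x-y)\cdot\xi}\sqrt{\Big(\xi-A\big(\tfrac{x+y}2\big)\Big)^2+m^2}\;f(y)\,dy\,d\xi,$$ $$(H_A^{(2)}f)(x)=\frac1{(2\pi)^d}\,\mathrm{Os}\text{-}\!\iint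 e^{i(x-y)\cdot\xi}\sqrt{\Big(\xi-\int_0^1A((1-\theta)x+\theta y)\,d\theta\Big)^2+m^2}\;f(y)\,dy\,d\xi,$$ where the integrals are oscillatory integrals in the variables $(\xi,y-x)$. For $A\in L^2_{\rm loc}(\mathbb R^d;\mathbb R^d)$ let $(-i\nabla-A)^2+m^2$ be the operator in $L^2(\mathbb R^d)$ associated with the quadratic form $\|(-i\nabla-A)u\|^2+m^2\|u\|^2$ with form domain $\{u\in L^2(\mathbb R^d):(-i\nabla-A)u\in L^2\}$ (derivatives in the sense of distributions), and let $H_A^{(3)}=\sqrt{(-i\nabla-A)^2+m^2}$ be its nonnegative selfadjoint square root. Then these operators are well defined: for tempered $A$, all $f\in C_0^\infty(\mathbb R^d)$ and all $x$, the two oscillatory integrals exist, and for $A\in L^2_{\rm loc}$ the operator $(-i\nabla-A)^2+m^2$ has exactly one nonnegative selfadjoint square root. Moreover: 1. For all tempered $A$ and all real-valued $\varphi\in\mathcal S(\mathbb R^d)$, $H^{(2)}_{A+\nabla\varphi}f=e^{i\varphi}H^{(2)}_A(e^{-i\varphi}f)$ for every $f\in C_0^\infty(\mathbb R^d)$. 2.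 For all $A\in L^2_{\rm loc}(\mathbb R^d;\mathbb R^d)$ and all real-valued $\varphi\in\mathcal S(\mathbb R^d)$, $H^{(3)}_{A+\nabla\varphi}=e^{i\varphi}H^{(3)}_Ae^{-i\varphi}$ as (unbounded) operators in $L^2(\mathbb R^d)$, including equality of domains. 3. $H^{(1)}_A$ is not gauge covariant: if $d\ge1$, then for every tempered $A$ there are a real-valued $\varphi\in\mathcal S(\mathbb R^d)$ and an $f\in C_0^\infty(\mathbb R^d)$ such that $H^{(1)}_{A+\nabla\varphi}f\ne e^{i\varphi}H^{(1)}_A(e^{-i\varphi}f)$. -/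

import Mathlib

open MeasureTheory Filter Topology Complex
open scoped ContDiff SchwartzMap InnerProductSpace

noncomputable section

namespace MagRel

/-- The space `ℝ^d` with its Euclidean norm. -/
abbrev E (d : ℕ) : Type := EuclideanSpace ℝ (Fin d)

/-- The complex Hilbert space `L²(ℝ^d)`. -/
abbrev L2 (d : ℕ) : Type := Lp ℂ 2 (volume : Measure (E d))

/-- `f ∈ C₀^∞(ℝ^d)`, complex valued. -/
def IsTest {d : ℕ} (f : E d → ℂ) : Prop :=
  ContDiff ℝ ∞ f ∧ HasCompactSupport f

/-- Smooth vector potentials all of whose derivatives satisfy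
`|∂^β A(x)| ≤ C_β ⟨x⟩^τ`, with one exponent `τ ≥ 0` for all orders. -/
def IsTemperate {d : ℕ} (A : E d → E d) : Prop :=
  ContDiff ℝ ∞ A ∧
    ∃ τ : ℝ, 0 ≤ τ ∧ ∀ n : ℕ, ∃ C : ℝ, ∀ x : E d,
      ‖iteratedFDeriv ℝ n A x‖ ≤ C * (1 + ‖x‖ ^ 2) ^ (τ / 2)

/-- `A ∈ L²_loc(ℝ^d; ℝ^d)`. -/
def IsL2Loc {d : ℕ} (A : E d → E d) : Prop :=
  ∀ K : Set (E d), IsCompact K → MemLp A 2 (volume.restrict K)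

/-- The gauge transformed potential `A + ∇φ`. -/
def gauge {d : ℕ} (A : E d → E d) (φ : 𝓢(E d, ℝ)) : E d → E d :=
  fun x => A x + gradient (fun z => φ z) x

/-! ### Oscillatory integrals and the two pseudo-differential operators -/

/-- `L` is the value of the oscillatory integral `Os-∬ e^{-i y·η} a(η, y) dy dη`: for every
cutoff `χ ∈ 𝓢(ℝ^d × ℝ^d)` with `χ(0,0) = 1` the regularized integrals converge absolutely and
tend to `L` as `ε → 0+`. -/
def HasOscIntegral {d : ℕ} (a : E d → E d → ℂ) (L : ℂ) : Prop :=
  ∀ χ : 𝓢(E d × E d, ℂ), χ (0, 0) = 1 →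
    (∀ ε : ℝ, 0 < ε → Integrable (fun p : E d × E d =>
        cexp (-I * ((⟪p.2, p.1⟫_ℝ : ℝ) : ℂ)) * χ (ε • p.1, ε • p.2) * a p.1 p.2)) ∧
    Tendsto (fun ε : ℝ => ∫ p : E d × E d,
        cexp (-I * ((⟪p.2, p.1⟫_ℝ : ℝ) : ℂ)) * χ (ε • p.1, ε • p.2) * a p.1 p.2)
      (𝓝[>] 0) (𝓝 L)

/-- The value of the oscillatory integral (and `0` if it does not exist). -/
def oscIntegral {d : ℕ} (a : E d → E d → ℂ) : ℂ :=
  open Classical in if h : ∃ L, HasOscIntegral a L then h.choose else 0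

/-- The midpoint prescription `A((x+y)/2)`. -/
def midA {d : ℕ} (A : E d → E d) (x y : E d) : E d :=
  A ((1 / 2 : ℝ) • (x + y))

/-- The averaged prescription `∫₀¹ A((1-θ)x + θy) dθ`. -/
def avgA {d : ℕ} (A : E d → E d) (x y : E d) : E d :=
  ∫ θ in (0 : ℝ)..1, A ((1 - θ) • x + θ • y)

/-- The amplitude `√((ξ - B(x,y'))² + m²) f(y')`, where `y' = x + y`, so that
`e^{i(x-y')·ξ} = e^{-iy·ξ}`. -/
def amplitude {d : ℕ} (m : ℝ) (B : E d → E d → E d) (f : E d → ℂ) (x : E d) :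
    E d → E d → ℂ :=
  fun ξ y => ((Real.sqrt (‖ξ - B x (x + y)‖ ^ 2 + m ^ 2) : ℝ) : ℂ) * f (x + y)

/-- `(2π)^{-d} Os-∬ e^{i(x-y)·ξ} √((ξ - B(x,y))² + m²) f(y) dy dξ`. -/
def pseudoDiff {d : ℕ} (m : ℝ) (B : E d → E d → E d) (f : E d → ℂ) (x : E d) : ℂ :=
  (((2 * Real.pi) ^ d : ℝ) : ℂ)⁻¹ * oscIntegral (amplitude m B f x)

/-- The Weyl operator `H_A^{(1)}`. -/
def H1 {d : ℕ} (m : ℝ) (A : E d → E d) (f : E d → ℂ) : E d → ℂ :=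
  pseudoDiff m (midA A) f

/-- The modified operator `H_A^{(2)}`. -/
def H2 {d : ℕ} (m : ℝ) (A : E d → E d) (f : E d → ℂ) : E d → ℂ :=
  pseudoDiff m (avgA A) f

/-- `e^{iφ} f` for a function `f`. -/
def mulPhase {d : ℕ} (φ : 𝓢(E d, ℝ)) (f : E d → ℂ) : E d → ℂ :=
  fun x => cexp (I * ((φ x : ℝ) : ℂ)) * f x

/-! ### The square root of the magnetic Schrödinger operator -/

/-- `(-i∂_j - A_j) u = v` in the sense of distributions, for `u, v ∈ L²`. The integrability
clause says that the left-hand side is a distribution; it is automatic for `A ∈ L²_loc`. -/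
def IsMagDeriv {d : ℕ} (A : E d → E d) (j : Fin d) (u v : L2 d) : Prop :=
  ∀ ψ : E d → ℂ, IsTest ψ →
    Integrable (fun x => u x *
      (I * fderiv ℝ ψ x (EuclideanSpace.single j 1) - ((A x j : ℝ) : ℂ) * ψ x)) ∧
    ∫ x, u x * (I * fderiv ℝ ψ x (EuclideanSpace.single j 1) - ((A x j : ℝ) : ℂ) * ψ x) =
      ∫ x, v x * ψ x

theorem integrable_mul_test {d : ℕ} (v : L2 d) {ψ : E d → ℂ} (hψ : IsTest ψ) :
    Integrable (fun x => v x * ψ x) := by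
  have h2 : MemLp ψ 2 (volume : Measure (E d)) :=
    hψ.1.continuous.memLp_of_hasCompactSupport hψ.2
  exact (Lp.memLp v).integrable_mul h2

theorem IsMagDeriv.zero {d : ℕ} (A : E d → E d) (j : Fin d) : IsMagDeriv A j 0 0 := by
  intro ψ _
  have h0 : ∀ g : E d → ℂ, (fun x => (0 : L2 d) x * g x) =ᵐ[volume] fun _ => 0 := by
    intro g
    filter_upwards [Lp.coeFn_zero ℂ 2 (volume : Measure (E d))] with x hx
    rw [hx, Pi.zero_apply, zero_mul]
  refine ⟨(integrable_zero _ _ _).congr (h0 _).symm, ?_⟩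
  rw [integral_congr_ae (h0 _), integral_congr_ae (h0 ψ)]

theorem IsMagDeriv.add {d : ℕ} {A : E d → E d} {j : Fin d} {u v u' v' : L2 d}
    (h : IsMagDeriv A j u v) (h' : IsMagDeriv A j u' v') :
    IsMagDeriv A j (u + u') (v + v') := by
  intro ψ hψ
  have h0 : ∀ (a b : L2 d) (g : E d → ℂ),
      (fun x => (a + b : L2 d) x * g x) =ᵐ[volume] fun x => a x * g x + b x * g x := by
    intro a b g
    filter_upwards [Lp.coeFn_add a b] with x hx
    rw [hx, Pi.add_apply, add_mul]
  obtain ⟨h1, h2⟩ := h ψ hψ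
  obtain ⟨h1', h2'⟩ := h' ψ hψ
  refine ⟨(h1.add h1').congr (h0 _ _ _).symm, ?_⟩
  rw [integral_congr_ae (h0 _ _ _), integral_congr_ae (h0 v v' ψ), integral_add h1 h1',
    integral_add (integrable_mul_test v hψ) (integrable_mul_test v' hψ), h2, h2']

theorem IsMagDeriv.smul {d : ℕ} {A : E d → E d} {j : Fin d} {u v : L2 d} (c : ℂ)
    (h : IsMagDeriv A j u v) : IsMagDeriv A j (c • u) (c • v) := by
  intro ψ hψ
  have h0 : ∀ (a : L2 d) (g : E d → ℂ),
      (fun x => (c • a : L2 d) x * g x) =ᵐ[volume] fun x => c * (a x * g x) := by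
    intro a g
    filter_upwards [Lp.coeFn_smul c a] with x hx
    rw [hx, Pi.smul_apply, smul_eq_mul, mul_assoc]
  obtain ⟨h1, h2⟩ := h ψ hψ
  refine ⟨(h1.const_mul c).congr (h0 _ _).symm, ?_⟩
  rw [integral_congr_ae (h0 _ _), integral_congr_ae (h0 v ψ), integral_const_mul,
    integral_const_mul, h2]

/-- The graph of the operator `(-i∇-A)² + m²` in `L²(ℝ^d)` that belongs to the quadratic form
`h[v,u] = ∑_j ⟪(-i∂_j-A_j)v, (-i∂_j-A_j)u⟫ + m²⟪v,u⟫` with form domain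
`{u ∈ L² | (-i∇-A)u ∈ L²}`: the pairs `(u,w)` with `u` in the form domain and
`h[v,u] = ⟪v,w⟫` for all `v` in the form domain. -/
def magGraph {d : ℕ} (m : ℝ) (A : E d → E d) : Submodule ℂ (L2 d × L2 d) where
  carrier := {z | ∃ p : Fin d → L2 d, (∀ j, IsMagDeriv A j z.1 (p j)) ∧
    ∀ (v : L2 d) (q : Fin d → L2 d), (∀ j, IsMagDeriv A j v (q j)) →
      ∑ j, ⟪q j, p j⟫_ℂ + ((m ^ 2 : ℝ) : ℂ) * ⟪v, z.1⟫_ℂ = ⟪v, z.2⟫_ℂ}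
  zero_mem' := ⟨0, fun j => IsMagDeriv.zero A j, fun v q _ => by simp⟩
  add_mem' := by
    rintro ⟨u, w⟩ ⟨u', w'⟩ ⟨p, hp, h⟩ ⟨p', hp', h'⟩
    refine ⟨p + p', fun j => (hp j).add (hp' j), fun v q hq => ?_⟩
    have e := h v q hq
    have e' := h' v q hq
    simp only [Prod.mk_add_mk, Pi.add_apply, inner_add_right, Finset.sum_add_distrib] at e e' ⊢
    rw [← e, ← e']
    ring
  smul_mem' := by
    rintro c ⟨u, w⟩ ⟨p, hp, h⟩
    refine ⟨c • p, fun j => (hp j).smul c, fun v q hq => ?_⟩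
    have e := h v q hq
    simp only [Prod.smul_mk, Pi.smul_apply, inner_smul_right, ← Finset.mul_sum] at e ⊢
    rw [← e]
    ring

/-- `S` is a nonnegative selfadjoint square root of the operator with graph `G`:
`S* = S ≥ 0`, and `G` is the graph of `S ∘ S` on its natural domain. -/
def IsNonnegSqrt {d : ℕ} (S : L2 d →ₗ.[ℂ] L2 d) (G : Submodule ℂ (L2 d × L2 d)) : Prop :=
  Dense (S.domain : Set (L2 d)) ∧ IsSelfAdjoint S ∧
    (∀ u : S.domain, 0 ≤ (⟪(u : L2 d), S u⟫_ℂ).re) ∧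
    ∀ u w : L2 d, (u, w) ∈ G ↔ ∃ v : L2 d, (u, v) ∈ S.graph ∧ (v, w) ∈ S.graph

/-- `H_A^{(3)} = √((-i∇-A)² + m²)`, the nonnegative selfadjoint square root. -/
def H3 {d : ℕ} (m : ℝ) (A : E d → E d) : L2 d →ₗ.[ℂ] L2 d :=
  Classical.epsilon fun S => IsNonnegSqrt S (magGraph m A)

theorem memLp_mulPhase {d : ℕ} (φ : 𝓢(E d, ℝ)) (u : L2 d) :
    MemLp (mulPhase φ u) 2 (volume : Measure (E d)) := by
  have hc : Continuous fun x : E d => cexp (I * ((φ x : ℝ) : ℂ)) := by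
    have := φ.continuous
    fun_prop
  refine (Lp.memLp u).of_le (hc.aestronglyMeasurable.mul (Lp.aestronglyMeasurable u)) ?_
  refine Eventually.of_forall fun x => ?_
  simp [mulPhase, mul_comm I, Complex.norm_exp_ofReal_mul_I]

/-- The multiplication operator `e^{iφ}` on `L²(ℝ^d)`. -/
def phaseOp {d : ℕ} (φ : 𝓢(E d, ℝ)) : L2 d →ₗ[ℂ] L2 d where
  toFun u := (memLp_mulPhase φ u).toLp
  map_add' u v := by
    rw [← MemLp.toLp_add]
    refine MemLp.toLp_congr _ _ ?_
    filter_upwards [Lp.coeFn_add u v] with x hx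
    simp only [mulPhase, Pi.add_apply]
    rw [hx, Pi.add_apply, mul_add]
  map_smul' c u := by
    rw [RingHom.id_apply, ← MemLp.toLp_const_smul]
    refine MemLp.toLp_congr _ _ ?_
    filter_upwards [Lp.coeFn_smul c u] with x hx
    simp only [mulPhase, Pi.smul_apply, smul_eq_mul]
    rw [hx, Pi.smul_apply, smul_eq_mul, mul_left_comm]

/-- The operator `e^{iφ} S e^{-iφ}` with domain `{u | e^{-iφ}u ∈ D(S)}`. -/
def gaugeConj {d : ℕ} (φ : 𝓢(E d, ℝ)) (S : L2 d →ₗ.[ℂ] L2 d) : L2 d →ₗ.[ℂ] L2 d where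
  domain := S.domain.comap (phaseOp (-φ))
  toFun := phaseOp φ ∘ₗ S.toFun ∘ₗ (phaseOp (-φ)).restrict (fun _ hu => hu)

end MagRel

end

/-! For $H^{(3)}$, multiplication by $e^{i\varphi}$ is unitary and carries the form of $A$ to the
form of $A+\nabla\varphi$, by the Leibniz rule in `IsMagDeriv.phaseOp`. It therefore carries a
nonnegative selfadjoint square root of one operator to one of the other, and uniqueness of the
square root gives covariance. Existence and uniqueness come from the resolvent $R$ at $-1$, which is
bounded, injective and satisfies $0\le R\le1$: the square root is $(1-R)^{1/2}R^{-1/2}$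
(`existsUnique_isGraphSqrt`). The resolvent is built from the closed form by an orthogonal
projection, as in the Riesz representation theorem.

For $H^{(1)}$ and $H^{(2)}$, the substitution $\xi=\zeta+B$ turns the symbol into
$\sqrt{\zeta^2+m^2}$ and moves the potential into a phase $e^{-iy\cdot B}$ on $f$. The oscillatory
integral becomes the absolutely convergent integral `sqrtSymbolAtZero` of the twisted function
(`hasOscIntegral_sqrt`). Only $y\cdot B$ matters. For the averaged potential, $\nabla\varphi$
contributes $\varphi(x+y)-\varphi(x)$ to it, which is exactly the gauge phase.

For the midpoint potential, choose $\varphi$ with $\varphi(0)=0$ and $\varphi=1$ near a unit vector,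
but $\nabla\varphi=0$ at the midpoints between $0$ and that neighbourhood. At $x=0$ covariance would
force $\Lambda=e^{-i}\Lambda$, where $\Lambda$ is the value at the origin, up to a factor, of
$\sqrt{-\Delta+m^2}\,u$ for a bump $u$ away from the origin. But $\Lambda\ne0$ by nonlocality
(`sqrtSymbolAtZero_ne_zero`), proved by writing the square root as a superposition of heat
semigroups, whose kernels are positive. -/

noncomputable section

namespace MagRel

/-! ### Nonnegative selfadjoint square roots in a Hilbert space -/

section SquareRoot

variable {H : Type*} [NormedAddCommGroup H] [InnerProductSpace ℂ H]

/-- The graph `{(a v, b v)}` of `b a⁻¹`. -/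
def ratioGraph (a b : H →L[ℂ] H) : Submodule ℂ (H × H) :=
  LinearMap.range ((a : H →ₗ[ℂ] H).prod (b : H →ₗ[ℂ] H))

theorem mem_ratioGraph {a b : H →L[ℂ] H} {x y : H} :
    (x, y) ∈ ratioGraph a b ↔ ∃ v, a v = x ∧ b v = y := by
  simp [ratioGraph]

theorem inner_apply_comm_of_nonneg {a : H →L[ℂ] H} (ha : 0 ≤ a) (x y : H) :
    ⟪a x, y⟫_ℂ = ⟪x, a y⟫_ℂ :=
  ((ContinuousLinearMap.nonneg_iff_isPositive a).1 ha).isSymmetric x y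

theorem re_inner_apply_nonneg {a : H →L[ℂ] H} (ha : 0 ≤ a) (x : H) :
    0 ≤ (⟪x, a x⟫_ℂ).re :=
  ((ContinuousLinearMap.nonneg_iff_isPositive a).1 ha).re_inner_nonneg_right x

/-- The operator `b a⁻¹`. -/
def ratioOp (a b : H →L[ℂ] H) : H →ₗ.[ℂ] H := (ratioGraph a b).toLinearPMap

theorem ratioOp_graph {a b : H →L[ℂ] H} (ha : Function.Injective a) :
    (ratioOp a b).graph = ratioGraph a b := by
  apply Submodule.toLinearPMap_graph_eq
  rintro ⟨x, y⟩ hx (h0 : x = 0)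
  obtain ⟨v, h1, h2⟩ := mem_ratioGraph.1 hx
  rw [h0, ← map_zero a] at h1
  rw [ha h1, map_zero] at h2
  exact h2.symm

variable [CompleteSpace H]

/-- A densely defined operator is selfadjoint iff its graph is its own adjoint. -/
theorem isSelfAdjoint_iff_graph {S : H →ₗ.[ℂ] H} (hS : Dense (S.domain : Set H)) :
    IsSelfAdjoint S ↔ ∀ x y : H, (x, y) ∈ S.graph ↔
      ∀ a b : H, (a, b) ∈ S.graph → ⟪b, x⟫_ℂ = ⟪a, y⟫_ℂ := by
  rw [LinearPMap.isSelfAdjoint_def]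
  constructor
  · intro h x y
    conv_lhs => rw [← h, LinearPMap.adjoint_graph_eq_graph_adjoint hS]
    simp only [Submodule.mem_adjoint_iff, sub_eq_zero]
  · intro h
    apply LinearPMap.eq_of_eq_graph
    rw [LinearPMap.adjoint_graph_eq_graph_adjoint hS]
    ext ⟨x, y⟩
    rw [h x y]
    simp only [Submodule.mem_adjoint_iff, sub_eq_zero]

/-- Taking adjoints reverses inclusions, so a selfadjoint operator has no proper selfadjoint
extension. -/
theorem eq_of_le_of_isSelfAdjoint {S T : H →ₗ.[ℂ] H} (hS : IsSelfAdjoint S)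
    (hT : IsSelfAdjoint T) (h : S.graph ≤ T.graph) : S = T := by
  apply LinearPMap.eq_of_eq_graph
  refine le_antisymm h ?_
  rintro ⟨x, y⟩ hxy
  rw [(isSelfAdjoint_iff_graph hS.dense_domain).1 hS]
  intro a b hab
  exact ((isSelfAdjoint_iff_graph hT.dense_domain).1 hT x y).1 hxy a b (h hab)

/-- `S = S* ≥ 0` and `G` is the graph of `S ∘ S`. -/
def IsGraphSqrt (S : H →ₗ.[ℂ] H) (G : Submodule ℂ (H × H)) : Prop :=
  Dense (S.domain : Set H) ∧ IsSelfAdjoint S ∧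
    (∀ u : S.domain, 0 ≤ (⟪(u : H), S u⟫_ℂ).re) ∧
    ∀ u w : H, (u, w) ∈ G ↔ ∃ v : H, (u, v) ∈ S.graph ∧ (v, w) ∈ S.graph

theorem IsGraphSqrt.re_nonneg {S : H →ₗ.[ℂ] H} {G : Submodule ℂ (H × H)} (h : IsGraphSqrt S G)
    {u v : H} (huv : (u, v) ∈ S.graph) : 0 ≤ (⟪u, v⟫_ℂ).re := by
  rw [LinearPMap.mem_graph_iff] at huv
  obtain ⟨y, rfl, rfl⟩ := huv
  exact h.2.2.1 y

theorem IsGraphSqrt.symm {S : H →ₗ.[ℂ] H} {G : Submodule ℂ (H × H)} (h : IsGraphSqrt S G)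
    {u v a b : H} (huv : (u, v) ∈ S.graph) (hab : (a, b) ∈ S.graph) :
    ⟪b, u⟫_ℂ = ⟪a, v⟫_ℂ :=
  ((isSelfAdjoint_iff_graph h.1).1 h.2.1 u v).1 huv a b hab

theorem dense_range_of_injective_of_nonneg {a : H →L[ℂ] H} (ha : 0 ≤ a)
    (hinj : Function.Injective a) : Dense (LinearMap.range (a : H →ₗ[ℂ] H) : Set H) := by
  rw [Submodule.dense_iff_topologicalClosure_eq_top,
    Submodule.topologicalClosure_eq_top_iff, Submodule.eq_bot_iff]
  intro x hx
  rw [Submodule.mem_orthogonal] at hx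
  apply hinj
  rw [map_zero, ← inner_self_eq_zero (𝕜 := ℂ), ← inner_apply_comm_of_nonneg ha]
  exact hx _ ⟨a x, rfl⟩

/-- The model is $a=R^{1/2}$, $b=(1-R)^{1/2}$: then $(ba^{-1})^2=(1-R)R^{-1}=R^{-1}-1$, the operator
whose resolvent at $-1$ is $R=a^2$. -/
theorem ratioOp_isGraphSqrt {a b : H →L[ℂ] H} (ha : 0 ≤ a) (hb : 0 ≤ b) (hab : Commute a b)
    (hsum : a * a + b * b = 1) (hinj : Function.Injective a) {G : Submodule ℂ (H × H)}
    (hG : ∀ u w, (u, w) ∈ G ↔ a (a (u + w)) = u) : IsGraphSqrt (ratioOp a b) G := by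
  have hc : ∀ x, a (b x) = b (a x) := fun x => congr($(hab.eq) x)
  have hs : ∀ x, a (a x) + b (b x) = x := fun x => congr($hsum x)
  have hdense : Dense ((ratioOp a b).domain : Set H) := by
    refine (dense_range_of_injective_of_nonneg ha hinj).mono ?_
    rintro _ ⟨v, rfl⟩
    refine LinearPMap.mem_domain_of_mem_graph (y := b v) ?_
    rw [ratioOp_graph hinj]
    exact mem_ratioGraph.2 ⟨v, rfl, rfl⟩
  refine ⟨hdense, ?_, ?_, ?_⟩
  · rw [isSelfAdjoint_iff_graph hdense, ratioOp_graph hinj]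
    intro x y
    simp only [mem_ratioGraph]
    constructor
    · rintro ⟨v, rfl, rfl⟩ _ _ ⟨w, rfl, rfl⟩
      rw [inner_apply_comm_of_nonneg hb, inner_apply_comm_of_nonneg ha, hc]
    · intro h
      have hxy : b x = a y := by
        refine ext_inner_left ℂ fun v => ?_
        rw [← inner_apply_comm_of_nonneg hb, ← inner_apply_comm_of_nonneg ha]
        exact h _ _ ⟨v, rfl, rfl⟩
      -- Since $a^2+b^2=1$, the map $(x,y)\mapsto ax+by$ is a left inverse of $v\mapsto(av,bv)$.
      refine ⟨a x + b y, ?_, ?_⟩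
      · rw [map_add, hc, ← hxy, hs]
      · rw [map_add, ← hc, hxy, hs]
  · intro u
    have hu := (ratioOp a b).mem_graph u
    rw [ratioOp_graph hinj] at hu
    obtain ⟨v, h1, h2⟩ := mem_ratioGraph.1 hu
    rw [← h1, ← h2, inner_apply_comm_of_nonneg ha]
    exact re_inner_apply_nonneg (Commute.mul_nonneg ha hb hab) v
  · intro u w
    rw [hG, ratioOp_graph hinj]
    simp only [mem_ratioGraph]
    constructor
    · intro h
      -- With $z=u+w$: $u=a^2z$ is sent to $baz$, and this to $b^2z=z-a^2z=w$.
      refine ⟨b (a (u + w)), ⟨a (u + w), h, rfl⟩, ⟨b (u + w), hc _, ?_⟩⟩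
      have := hs (u + w)
      rw [h] at this
      exact add_left_cancel this
    · rintro ⟨v, ⟨p, rfl, rfl⟩, ⟨q, h1, rfl⟩⟩
      rw [map_add a, hc, h1, hs]

/-- Two nonnegative selfadjoint square roots of an operator `G` whose resolvent at `-1` is
`a²` agree. -/
theorem ratioOp_unique {a b : H →L[ℂ] H} (ha : 0 ≤ a) (hb : 0 ≤ b) (hab : Commute a b)
    (hsum : a * a + b * b = 1) (hinj : Function.Injective a) {G : Submodule ℂ (H × H)}
    (hG : ∀ u w, (u, w) ∈ G ↔ a (a (u + w)) = u) {S : H →ₗ.[ℂ] H} (hS : IsGraphSqrt S G) :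
    S = ratioOp a b := by
  have hc : ∀ x, a (b x) = b (a x) := fun x => congr($(hab.eq) x)
  have hs : ∀ x, a (a x) + b (b x) = x := fun x => congr($hsum x)
  have hcan := ratioOp_isGraphSqrt ha hb hab hsum hinj hG
  have hGz : ∀ z, (a (a z), b (b z)) ∈ G := fun z => by rw [hG, hs]
  -- Here $cz=S(a^2z)$ and $S(cz)=b^2z$. The plan is to show that $c$ is bounded and nonnegative
  -- with $c^2=(ab)^2$. Uniqueness of nonnegative square roots of bounded operators then gives
  -- $c=ab$, so $S$ agrees with $ba^{-1}$ on the range of $a^2$.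
  choose c hc1 hc2 using fun z => (hS.2.2.2 _ _).1 (hGz z)
  have hadd : ∀ y z, c (y + z) = c y + c z := fun y z =>
    S.mem_graph_snd_inj (hc1 (y + z)) (S.graph.add_mem (hc1 y) (hc1 z)) (by simp)
  have hsmul : ∀ (t : ℂ) (z), c (t • z) = t • c z := fun t z =>
    S.mem_graph_snd_inj (hc1 (t • z)) (S.graph.smul_mem t (hc1 z)) (by simp)
  have hsymm : ∀ y z, ⟪c y, z⟫_ℂ = ⟪y, c z⟫_ℂ := fun y z => by
    conv_lhs => rw [← hs z]
    conv_rhs => rw [← hs y]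
    rw [inner_add_left, inner_add_right, hS.symm (hc1 z) (hc1 y), hS.symm (hc2 z) (hc2 y)]
  let c₀ : H →ₗ[ℂ] H := { toFun := c, map_add' := hadd, map_smul' := hsmul }
  -- Hellinger–Toeplitz: a symmetric operator defined everywhere is bounded.
  let C : H →L[ℂ] H := ⟨c₀, LinearMap.IsSymmetric.continuous (T := c₀) hsymm⟩
  have hC0 : 0 ≤ C := by
    rw [ContinuousLinearMap.nonneg_iff_isPositive, ContinuousLinearMap.isPositive_iff_complex]
    intro z
    have h1 : ⟪C z, z⟫_ℂ = ⟪c z, a (a z)⟫_ℂ + ⟪c z, b (b z)⟫_ℂ := by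
      rw [← inner_add_right, hs]; rfl
    have hre : 0 ≤ (⟪C z, z⟫_ℂ).re := by
      rw [h1, add_re]
      refine add_nonneg ?_ (hS.re_nonneg (hc2 z))
      rw [hS.symm (hc1 z) (hc1 z)]
      exact hS.re_nonneg (hc1 z)
    refine ⟨?_, hre⟩
    refine Complex.conj_eq_iff_re.1 ?_
    rw [inner_conj_symm]
    exact (hsymm z z).symm
  have hCC : C * C = a * b * (a * b) := by
    ext z
    refine ext_inner_left ℂ fun x => ?_
    change ⟪x, c (c z)⟫_ℂ = ⟪x, a (b (a (b z)))⟫_ℂ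
    rw [← hsymm, hS.symm (hc2 z) (hc1 x), inner_apply_comm_of_nonneg ha,
      inner_apply_comm_of_nonneg ha, ← hc (b z)]
  have hCab : C = a * b :=
    (CFC.mul_self_eq_mul_self_iff C (a * b) hC0 (Commute.mul_nonneg ha hb hab)).1 hCC
  symm
  refine eq_of_le_of_isSelfAdjoint hcan.2.1 hS.2.1 ?_
  rw [ratioOp_graph hinj]
  rintro ⟨_, _⟩ hxy
  obtain ⟨v, rfl, rfl⟩ := mem_ratioGraph.1 hxy
  have hclosed : IsClosed {v : H | (a v, b v) ∈ S.graph} :=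
    (show IsClosed (S.graph : Set (H × H)) from hS.2.1.isClosed).preimage
      (a.continuous.prodMk b.continuous)
  -- For $v=az$ the pair $(av,bv)$ is $(a^2z,cz)$. Closedness of $S$ and density of the range of $a$
  -- extend this to every $v$.
  have hsub : closure (LinearMap.range (a : H →ₗ[ℂ] H) : Set H) ⊆
      {v : H | (a v, b v) ∈ S.graph} := by
    refine closure_minimal ?_ hclosed
    rintro _ ⟨z, rfl⟩
    have h := hc1 z
    have h2 : c z = b (a z) := by
      rw [← hc]; exact congr($hCab z)
    rw [h2] at h
    exact h
  exact hsub (dense_range_of_injective_of_nonneg ha hinj v)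

/-- An operator whose resolvent at `-1` is an injective `R` with `0 ≤ R ≤ 1` has exactly one
nonnegative selfadjoint square root. -/
theorem existsUnique_isGraphSqrt {R : H →L[ℂ] H} (h0 : 0 ≤ R) (h1 : R ≤ 1)
    (hinj : Function.Injective R) {G : Submodule ℂ (H × H)}
    (hG : ∀ u w, (u, w) ∈ G ↔ R (u + w) = u) : ∃! S : H →ₗ.[ℂ] H, IsGraphSqrt S G := by
  have h1' : 0 ≤ 1 - R := sub_nonneg.2 h1
  have haa : CFC.sqrt R * CFC.sqrt R = R := CFC.sqrt_mul_sqrt_self R h0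
  have hbb : CFC.sqrt (1 - R) * CFC.sqrt (1 - R) = 1 - R := CFC.sqrt_mul_sqrt_self _ h1'
  have hcomm : Commute (CFC.sqrt R) (CFC.sqrt (1 - R)) := by
    have h : Commute R (CFC.sqrt (1 - R)) := by
      rw [CFC.sqrt_eq_cfc (a := 1 - R)]
      exact (((Commute.one_left R).sub_left (Commute.refl R)).cfc_nnreal _).symm
    rw [CFC.sqrt_eq_cfc (a := R)]
    exact h.cfc_nnreal _
  have hsum : CFC.sqrt R * CFC.sqrt R + CFC.sqrt (1 - R) * CFC.sqrt (1 - R) = 1 := by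
    rw [haa, hbb, add_sub_cancel]
  have hR : ∀ x, CFC.sqrt R (CFC.sqrt R x) = R x := fun x => congr($haa x)
  have hinj' : Function.Injective (CFC.sqrt R : H →L[ℂ] H) := by
    intro x y hxy
    apply hinj
    rw [← hR, hxy, hR]
  have hG' : ∀ u w, (u, w) ∈ G ↔ CFC.sqrt R (CFC.sqrt R (u + w)) = u := fun u w => by
    rw [hR, hG]
  exact ⟨_, ratioOp_isGraphSqrt (CFC.sqrt_nonneg R) (CFC.sqrt_nonneg _) hcomm hsum hinj' hG',
    fun S hS => ratioOp_unique (CFC.sqrt_nonneg R) (CFC.sqrt_nonneg _) hcomm hsum hinj' hG' hS⟩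

end SquareRoot

/-! ### The resolvent of the operator of a closed form -/

section FormResolvent

variable {H H' : Type*} [NormedAddCommGroup H] [InnerProductSpace ℂ H] [CompleteSpace H]
  [NormedAddCommGroup H'] [InnerProductSpace ℂ H'] [CompleteSpace H']

/-- With `P` the orthogonal projection onto `V`, the operator `K⁻¹ π P π*`. -/
def formResolvent (π : H' →L[ℂ] H) (V : Submodule ℂ H') [V.HasOrthogonalProjection] (K : ℝ) :
    H →L[ℂ] H :=
  ((K⁻¹ : ℝ) : ℂ) • (π ∘L V.starProjection ∘L ContinuousLinearMap.adjoint π)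

variable {π : H' →L[ℂ] H} {V : Submodule ℂ H'} [V.HasOrthogonalProjection] {K : ℝ}

theorem inner_formResolvent_self (z : H) :
    ⟪formResolvent π V K z, z⟫_ℂ =
      ((K⁻¹ * ‖V.starProjection (ContinuousLinearMap.adjoint π z)‖ ^ 2 : ℝ) : ℂ) := by
  have h : ⟪V.starProjection (ContinuousLinearMap.adjoint π z),
      ContinuousLinearMap.adjoint π z⟫_ℂ =
      ((‖V.starProjection (ContinuousLinearMap.adjoint π z)‖ ^ 2 : ℝ) : ℂ) := by
    have h1 := V.starProjection_inner_eq_zero (ContinuousLinearMap.adjoint π z)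
      (V.starProjection (ContinuousLinearMap.adjoint π z)) (V.starProjection_apply_mem _)
    rw [inner_sub_left, sub_eq_zero] at h1
    rw [← inner_conj_symm, h1, inner_self_eq_norm_sq_to_K]
    simp
  rw [formResolvent, _root_.smul_apply, inner_smul_left, conj_ofReal,
    ContinuousLinearMap.comp_apply, ContinuousLinearMap.comp_apply,
    ← ContinuousLinearMap.adjoint_inner_right, h]
  push_cast
  ring

theorem formResolvent_nonneg (hK : 0 ≤ K) : 0 ≤ formResolvent π V K := by
  rw [ContinuousLinearMap.nonneg_iff_isPositive, ContinuousLinearMap.isPositive_iff_complex]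
  intro z
  rw [inner_formResolvent_self]
  refine ⟨congrArg ofReal (ofReal_re _), ?_⟩
  have : 0 ≤ K⁻¹ * ‖V.starProjection (ContinuousLinearMap.adjoint π z)‖ ^ 2 := by positivity
  exact this

theorem formResolvent_le_one (hK : 1 ≤ K) (hπ : ‖π‖ ≤ 1) : formResolvent π V K ≤ 1 := by
  rw [← sub_nonneg, ContinuousLinearMap.nonneg_iff_isPositive,
    ContinuousLinearMap.isPositive_iff_complex]
  intro z
  have h1 : ⟪(1 - formResolvent π V K) z, z⟫_ℂ = ((‖z‖ ^ 2 -
      K⁻¹ * ‖V.starProjection (ContinuousLinearMap.adjoint π z)‖ ^ 2 : ℝ) : ℂ) := by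
    rw [_root_.sub_apply, inner_sub_left, inner_formResolvent_self,
      one_apply_eq_self, inner_self_eq_norm_sq_to_K]
    simp
  rw [h1]
  refine ⟨congrArg ofReal (ofReal_re _), ?_⟩
  have h2 : ‖V.starProjection (ContinuousLinearMap.adjoint π z)‖ ≤ ‖z‖ := by
    refine (V.norm_starProjection_apply_le _).trans ?_
    refine ((ContinuousLinearMap.adjoint π).le_opNorm z).trans ?_
    rw [LinearIsometryEquiv.norm_map]
    exact mul_le_of_le_one_left (norm_nonneg _) hπ
  have h3 : K⁻¹ * ‖V.starProjection (ContinuousLinearMap.adjoint π z)‖ ^ 2 ≤ 1 * ‖z‖ ^ 2 := by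
    gcongr
    exact inv_le_one_of_one_le₀ hK
  have : 0 ≤ ‖z‖ ^ 2 - K⁻¹ * ‖V.starProjection (ContinuousLinearMap.adjoint π z)‖ ^ 2 := by
    linarith
  exact this

/-- The quadratic form of the resolvent is $K^{-1}\|P\pi^*z\|^2$, so a vector in the kernel is
orthogonal to $\pi V$. The hypothesis `hV` says that $\pi V$ is dense. -/
theorem formResolvent_injective (hK : 0 < K)
    (hV : ∀ z : H, (∀ y ∈ V, ⟪π y, z⟫_ℂ = 0) → z = 0) :
    Function.Injective (formResolvent π V K) := by
  rw [injective_iff_map_eq_zero]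
  intro z hz
  have h := inner_formResolvent_self (π := π) (V := V) (K := K) z
  rw [hz, inner_zero_left, eq_comm, ofReal_eq_zero] at h
  have h0 : V.starProjection (ContinuousLinearMap.adjoint π z) = 0 := by
    simpa [hK.ne'] using h
  apply hV
  intro y hy
  have h1 := V.starProjection_inner_eq_zero (ContinuousLinearMap.adjoint π z) y hy
  rw [h0, sub_zero, ContinuousLinearMap.adjoint_inner_left] at h1
  exact inner_eq_zero_symm.1 h1

/-- Riesz representation: $\langle\pi y,z\rangle=\langle y,P\pi^*z\rangle$ for $y\in V$, so
$K^{-1}P\pi^*z$ is the only solution in $V$ of the variational equation. -/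
theorem formResolvent_apply_eq_iff (hK : 0 < K) (z u : H) :
    formResolvent π V K z = u ↔
      ∃ x ∈ V, π x = u ∧ ∀ y ∈ V, (K : ℂ) * ⟪y, x⟫_ℂ = ⟪π y, z⟫_ℂ := by
  have hK' : (K : ℂ) ≠ 0 := by exact_mod_cast hK.ne'
  constructor
  · intro h
    refine ⟨((K⁻¹ : ℝ) : ℂ) • V.starProjection (ContinuousLinearMap.adjoint π z),
      V.smul_mem _ (V.starProjection_apply_mem _), ?_, ?_⟩
    · rw [← h, map_smul]; rfl
    · intro y hy
      have h1 := V.starProjection_inner_eq_zero (ContinuousLinearMap.adjoint π z) y hy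
      rw [inner_sub_left, sub_eq_zero] at h1
      rw [inner_smul_right, ← mul_assoc, ofReal_inv, mul_inv_cancel₀ hK', one_mul,
        ← ContinuousLinearMap.adjoint_inner_right, ← inner_conj_symm, ← h1, inner_conj_symm]
  · rintro ⟨x, hx, rfl, h⟩
    have h1 : V.starProjection (ContinuousLinearMap.adjoint π z) = (K : ℂ) • x := by
      refine V.eq_starProjection_of_mem_of_inner_eq_zero (V.smul_mem _ hx) ?_
      intro y hy
      rw [inner_sub_left, sub_eq_zero, inner_smul_left, conj_ofReal, ← inner_conj_symm,
        ContinuousLinearMap.adjoint_inner_right, ← h y hy]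
      simp
    rw [formResolvent, _root_.smul_apply, ContinuousLinearMap.comp_apply,
      ContinuousLinearMap.comp_apply, h1, map_smul, smul_smul, ofReal_inv, inv_mul_cancel₀ hK',
      one_smul]

end FormResolvent

/-! ### Test functions -/

variable {d : ℕ}

theorem IsTest.fderiv_apply {ψ : E d → ℂ} (h : IsTest ψ) (v : E d) :
    IsTest fun x => fderiv ℝ ψ x v :=
  ⟨(h.1.fderiv_right (m := ∞) (by simp)).clm_apply contDiff_const, h.2.fderiv_apply ℝ v⟩

theorem IsTest.mul_left {ψ g : E d → ℂ} (h : IsTest ψ) (hg : ContDiff ℝ ∞ g) :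
    IsTest fun x => g x * ψ x :=
  ⟨hg.mul h.1, h.2.mul_left⟩

theorem IsTest.memLp {ψ : E d → ℂ} (h : IsTest ψ) : MemLp ψ 2 (volume : Measure (E d)) :=
  h.1.continuous.memLp_of_hasCompactSupport h.2

theorem IsL2Loc.memLp_mul_test {A : E d → E d} (hA : IsL2Loc A) (j : Fin d) {ψ : E d → ℂ}
    (hψ : IsTest ψ) : MemLp (fun x => ((A x j : ℝ) : ℂ) * ψ x) 2 (volume : Measure (E d)) := by
  have hK := hA _ hψ.2
  have h1 : MemLp (fun x => ((A x j : ℝ) : ℂ)) 2 (volume.restrict (tsupport ψ)) := by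
    have : MemLp (fun x => A x j) 2 (volume.restrict (tsupport ψ)) :=
      (EuclideanSpace.proj (𝕜 := ℝ) j).comp_memLp' hK
    exact this.ofReal
  obtain ⟨C, hC⟩ := hψ.2.exists_bound_of_continuous hψ.1.continuous
  have h2 : MemLp (fun x => ψ x * ((A x j : ℝ) : ℂ)) 2 (volume.restrict (tsupport ψ)) :=
    MemLp.of_le_mul (c := C) h1 (hψ.1.continuous.aestronglyMeasurable.mul h1.1)
      (Eventually.of_forall fun x => by rw [norm_mul]; gcongr; exact hC x)
  have h3 := (memLp_indicator_iff_restrict (isClosed_tsupport ψ).measurableSet).2 h2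
  refine (memLp_congr_ae (ae_of_all _ fun x => ?_)).1 h3
  by_cases hx : x ∈ tsupport ψ
  · simp [hx, mul_comm]
  · simp [hx, image_eq_zero_of_notMem_tsupport hx]

theorem IsL2Loc.memLp_magTest {A : E d → E d} (hA : IsL2Loc A) (j : Fin d) {ψ : E d → ℂ}
    (hψ : IsTest ψ) : MemLp (fun x => I * fderiv ℝ ψ x (EuclideanSpace.single j 1) -
      ((A x j : ℝ) : ℂ) * ψ x) 2 (volume : Measure (E d)) :=
  (((hψ.fderiv_apply _).memLp).const_mul I).sub (hA.memLp_mul_test j hψ)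

theorem integral_mul_eq_inner {g : E d → ℂ} (hg : MemLp g 2 (volume : Measure (E d)))
    (u : L2 d) : ∫ x, u x * g x = ⟪hg.star.toLp, u⟫_ℂ := by
  rw [L2.inner_def]
  refine integral_congr_ae ?_
  filter_upwards [hg.star.coeFn_toLp] with x hx
  rw [hx]
  simp [mul_comm]

/-- For $A\in L^2_{\rm loc}$ the weak equation pairs $u$ and $v$ with fixed $L^2$ vectors, hence is
preserved under $L^2$ limits. This makes the form closed. -/
theorem isMagDeriv_iff {A : E d → E d} (hA : IsL2Loc A) (j : Fin d) (u v : L2 d) :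
    IsMagDeriv A j u v ↔ ∀ (ψ : E d → ℂ) (hψ : IsTest ψ),
      ⟪(hA.memLp_magTest j hψ).star.toLp, u⟫_ℂ = ⟪hψ.memLp.star.toLp, v⟫_ℂ := by
  refine forall₂_congr fun ψ hψ => ?_
  rw [← integral_mul_eq_inner (hA.memLp_magTest j hψ), ← integral_mul_eq_inner hψ.memLp]
  exact and_iff_right ((Lp.memLp u).integrable_mul (hA.memLp_magTest j hψ))

/-- A test function lies in the form domain. -/
theorem IsTest.isMagDeriv {A : E d → E d} (hA : IsL2Loc A) (j : Fin d) {f : E d → ℂ}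
    (hf : IsTest f) : ∃ v : L2 d, IsMagDeriv A j hf.memLp.toLp v := by
  have hv : MemLp (fun x => (-I) * fderiv ℝ f x (EuclideanSpace.single j 1) -
      ((A x j : ℝ) : ℂ) * f x) 2 (volume : Measure (E d)) :=
    (((hf.fderiv_apply _).memLp).const_mul (-I)).sub (hA.memLp_mul_test j hf)
  refine ⟨hv.toLp, fun ψ hψ => ⟨(Lp.memLp _).integrable_mul (hA.memLp_magTest j hψ), ?_⟩⟩
  have e1 : ∫ x, (hf.memLp.toLp : L2 d) x * (I * fderiv ℝ ψ x (EuclideanSpace.single j 1) -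
      ((A x j : ℝ) : ℂ) * ψ x) = ∫ x, (I * (f x * fderiv ℝ ψ x (EuclideanSpace.single j 1)) -
      f x * (((A x j : ℝ) : ℂ) * ψ x)) := by
    refine integral_congr_ae ?_
    filter_upwards [hf.memLp.coeFn_toLp] with x hx
    rw [hx]; ring
  have e2 : ∫ x, (hv.toLp : L2 d) x * ψ x =
      ∫ x, ((-I) * (fderiv ℝ f x (EuclideanSpace.single j 1) * ψ x) -
      f x * (((A x j : ℝ) : ℂ) * ψ x)) := by
    refine integral_congr_ae ?_
    filter_upwards [hv.coeFn_toLp] with x hx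
    rw [hx]; ring
  have i1 : Integrable fun x => f x * fderiv ℝ ψ x (EuclideanSpace.single j 1) :=
    hf.memLp.integrable_mul (hψ.fderiv_apply _).memLp
  have i2 : Integrable fun x => fderiv ℝ f x (EuclideanSpace.single j 1) * ψ x :=
    (hf.fderiv_apply _).memLp.integrable_mul hψ.memLp
  have i3 : Integrable fun x => f x * (((A x j : ℝ) : ℂ) * ψ x) :=
    hf.memLp.integrable_mul (hA.memLp_mul_test j hψ)
  rw [e1, e2, integral_sub (i1.const_mul _) i3, integral_sub (i2.const_mul _) i3,
    integral_const_mul, integral_const_mul,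
    integral_mul_fderiv_eq_neg_fderiv_mul_of_integrable i2 i1 (hf.memLp.integrable_mul hψ.memLp)
      (fun x _ => hf.1.differentiable (by simp) x) (fun x _ => hψ.1.differentiable (by simp) x)]
  ring

theorem eq_zero_of_inner_test {z : L2 d}
    (h : ∀ (f : E d → ℂ) (hf : IsTest f), ⟪hf.memLp.toLp, z⟫_ℂ = 0) : z = 0 := by
  have hz : ∀ᵐ x, z x = 0 := by
    refine ae_eq_zero_of_integral_contDiff_smul_eq_zero
      ((Lp.memLp z).locallyIntegrable (by norm_num)) fun g hg hg' => ?_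
    have ht : IsTest fun x => ((g x : ℝ) : ℂ) :=
      ⟨ofRealCLM.contDiff.comp hg, hg'.comp_left (g := fun t : ℝ => (t : ℂ)) (by simp)⟩
    rw [← h _ ht, L2.inner_def]
    refine integral_congr_ae ?_
    filter_upwards [ht.memLp.coeFn_toLp] with x hx
    rw [hx]
    simp [mul_comm]
  exact (Lp.eq_zero_iff_ae_eq_zero).2 hz

/-! ### The magnetic operator -/

/-- The form domain, as a closed subspace of `L² ⊕ ⨁_j L²`. -/
def formSpace (A : E d → E d) (c : ℝ) : Submodule ℂ (PiLp 2 fun _ : Option (Fin d) => L2 d) where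
  carrier := {x | ∀ j, IsMagDeriv A j (x none) ((c : ℂ) • x (some j))}
  zero_mem' := fun j => by simpa using IsMagDeriv.zero A j
  add_mem' := fun {x y} hx hy j => by simpa using (hx j).add (hy j)
  smul_mem' := fun t x hx j => by
    have := (hx j).smul t
    rw [smul_comm] at this
    simpa using this

theorem isClosed_formSpace {A : E d → E d} (hA : IsL2Loc A) (c : ℝ) :
    IsClosed (formSpace A c : Set (PiLp 2 fun _ : Option (Fin d) => L2 d)) := by
  have : (formSpace A c : Set (PiLp 2 fun _ : Option (Fin d) => L2 d)) =
      ⋂ (j : Fin d), ⋂ (ψ : E d → ℂ), ⋂ (hψ : IsTest ψ),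
        {x | ⟪(hA.memLp_magTest j hψ).star.toLp, x none⟫_ℂ =
          ⟪hψ.memLp.star.toLp, (c : ℂ) • x (some j)⟫_ℂ} := by
    ext x
    simp only [Set.mem_iInter, Set.mem_ofPred_eq]
    exact forall_congr' fun j => isMagDeriv_iff hA j _ _
  rw [this]
  refine isClosed_iInter fun j => isClosed_iInter fun ψ => isClosed_iInter fun hψ => ?_
  refine isClosed_eq ?_ ?_ <;> fun_prop

/-- Dividing the derivative components by $c=\sqrt{1+m^2}$ makes $h[v,u]+\langle v,u\rangle$ equal
to $1+m^2$ times the inner product of $L^2\oplus\bigoplus_jL^2$. The operator equation becomes the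
variational equation of `formResolvent_apply_eq_iff` with $K=1+m^2\ge1$, also when $m=0$. -/
theorem mem_magGraph_iff (m : ℝ) (A : E d → E d) (u w : L2 d) :
    (u, w) ∈ magGraph m A ↔ ∃ x ∈ formSpace A √(1 + m ^ 2), x none = u ∧
      ∀ y ∈ formSpace A √(1 + m ^ 2),
        ((1 + m ^ 2 : ℝ) : ℂ) * ⟪y, x⟫_ℂ = ⟪y none, u + w⟫_ℂ := by
  set c : ℝ := √(1 + m ^ 2) with hc
  have hc0 : 0 < c := Real.sqrt_pos.2 (by positivity)
  have hcc : ((1 + m ^ 2 : ℝ) : ℂ) = c * c := by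
    rw [← ofReal_mul, hc, Real.mul_self_sqrt (by positivity)]
  have hc' : (c : ℂ) ≠ 0 := by exact_mod_cast hc0.ne'
  have key : ∀ x y : PiLp 2 fun _ : Option (Fin d) => L2 d,
      ((1 + m ^ 2 : ℝ) : ℂ) * ⟪y, x⟫_ℂ = ⟪y none, x none⟫_ℂ +
        (∑ j, ⟪(c : ℂ) • y (some j), (c : ℂ) • x (some j)⟫_ℂ +
          ((m ^ 2 : ℝ) : ℂ) * ⟪y none, x none⟫_ℂ) := by
    intro x y
    simp only [PiLp.inner_apply, Fintype.sum_option, inner_smul_left, inner_smul_right,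
      conj_ofReal, ← mul_assoc, ← hcc, ← Finset.mul_sum]
    push_cast
    ring
  constructor
  · rintro ⟨p, hp, h⟩
    refine ⟨WithLp.toLp 2 fun o => o.elim u fun j => (c : ℂ)⁻¹ • p j, fun j => ?_, rfl,
      fun y hy => ?_⟩
    · simpa [smul_smul, hc'] using hp j
    · rw [key, inner_add_right, ← h _ _ hy]
      simp [smul_smul, hc']
  · rintro ⟨x, hx, rfl, h⟩
    refine ⟨fun j => (c : ℂ) • x (some j), hx, fun v q hq => ?_⟩
    have := h (WithLp.toLp 2 fun o => o.elim v fun j => (c : ℂ)⁻¹ • q j) (fun j => by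
      simpa [smul_smul, hc'] using hq j)
    rw [key, inner_add_right] at this
    simpa [smul_smul, hc'] using this

theorem existsUnique_isNonnegSqrt (m : ℝ) {A : E d → E d} (hA : IsL2Loc A) :
    ∃! S : L2 d →ₗ.[ℂ] L2 d, IsNonnegSqrt S (magGraph m A) := by
  have hK : (1 : ℝ) ≤ 1 + m ^ 2 := by nlinarith [sq_nonneg m]
  let π : (PiLp 2 fun _ : Option (Fin d) => L2 d) →L[ℂ] L2 d :=
    PiLp.proj 2 (fun _ : Option (Fin d) => L2 d) none
  let V := formSpace A √(1 + m ^ 2)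
  have : CompleteSpace V := (isClosed_formSpace hA _).completeSpace_coe
  have hπ : ‖π‖ ≤ 1 :=
    π.opNorm_le_bound zero_le_one fun x => by rw [one_mul]; exact PiLp.norm_apply_le x none
  have hc : ((√(1 + m ^ 2) : ℝ) : ℂ) ≠ 0 := by
    exact_mod_cast (Real.sqrt_pos.2 (by positivity)).ne'
  refine existsUnique_isGraphSqrt (R := formResolvent π V (1 + m ^ 2))
    (formResolvent_nonneg (by positivity)) (formResolvent_le_one hK hπ)
    (formResolvent_injective (by positivity) ?_) ?_
  · intro z hz
    refine eq_zero_of_inner_test fun f hf => ?_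
    choose p hp using fun j => hf.isMagDeriv hA j
    exact hz (WithLp.toLp 2 fun o => o.elim hf.memLp.toLp
      fun j => ((√(1 + m ^ 2) : ℝ) : ℂ)⁻¹ • p j) (fun j => by simpa [smul_smul, hc] using hp j)
  · intro u w
    rw [mem_magGraph_iff, formResolvent_apply_eq_iff (by positivity)]
    rfl

/-! ### Gauge covariance of the square root -/

theorem coeFn_phaseOp (φ : 𝓢(E d, ℝ)) (u : L2 d) :
    phaseOp φ u =ᵐ[volume] mulPhase φ u :=
  (memLp_mulPhase φ u).coeFn_toLp

theorem phaseOp_neg_apply (φ : 𝓢(E d, ℝ)) (u : L2 d) : phaseOp (-φ) (phaseOp φ u) = u := by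
  apply Lp.ext
  filter_upwards [coeFn_phaseOp (-φ) (phaseOp φ u), coeFn_phaseOp φ u] with x h1 h2
  rw [h1, mulPhase, h2, mulPhase, ← mul_assoc, ← Complex.exp_add]
  simp

theorem phaseOp_apply_neg (φ : 𝓢(E d, ℝ)) (u : L2 d) : phaseOp φ (phaseOp (-φ) u) = u := by
  simpa using phaseOp_neg_apply (-φ) u

theorem inner_phaseOp (φ : 𝓢(E d, ℝ)) (u v : L2 d) :
    ⟪phaseOp φ u, phaseOp φ v⟫_ℂ = ⟪u, v⟫_ℂ := by
  rw [L2.inner_def, L2.inner_def]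
  refine integral_congr_ae ?_
  filter_upwards [coeFn_phaseOp φ u, coeFn_phaseOp φ v] with x h1 h2
  have h3 : cexp (I * ((φ x : ℝ) : ℂ)) * (starRingEnd ℂ) (cexp (I * ((φ x : ℝ) : ℂ))) = 1 := by
    rw [← Complex.exp_conj, ← Complex.exp_add]
    simp
  rw [h1, h2, mulPhase, mulPhase, RCLike.inner_apply, RCLike.inner_apply, map_mul]
  linear_combination (v x * (starRingEnd ℂ) (u x)) * h3

theorem inner_phaseOp_left (φ : 𝓢(E d, ℝ)) (u v : L2 d) :
    ⟪phaseOp φ u, v⟫_ℂ = ⟪u, phaseOp (-φ) v⟫_ℂ := by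
  rw [← inner_phaseOp φ u, phaseOp_apply_neg]

theorem gradient_apply (φ : 𝓢(E d, ℝ)) (x : E d) (j : Fin d) :
    gradient (fun z => φ z) x j = fderiv ℝ φ x (EuclideanSpace.single j 1) := by
  have h : ⟪gradient (fun z => φ z) x, EuclideanSpace.single j (1 : ℝ)⟫_ℝ =
      fderiv ℝ φ x (EuclideanSpace.single j 1) := by
    rw [gradient, InnerProductSpace.toDual_symm_apply]
  rw [← h, EuclideanSpace.inner_single_right]
  simp

theorem contDiff_phase (φ : 𝓢(E d, ℝ)) :
    ContDiff ℝ ∞ fun x : E d => cexp (I * ((φ x : ℝ) : ℂ)) :=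
  (contDiff_const.mul (ofRealCLM.contDiff.comp (φ.smooth ⊤))).cexp

theorem IsTest.mulPhase {ψ : E d → ℂ} (hψ : IsTest ψ) (φ : 𝓢(E d, ℝ)) :
    IsTest (MagRel.mulPhase φ ψ) :=
  hψ.mul_left (contDiff_phase φ)

theorem fderiv_mulPhase (φ : 𝓢(E d, ℝ)) {ψ : E d → ℂ} (hψ : IsTest ψ) (x v : E d) :
    fderiv ℝ (mulPhase φ ψ) x v =
      cexp (I * ((φ x : ℝ) : ℂ)) * (fderiv ℝ ψ x v + I * ((fderiv ℝ φ x v : ℝ) : ℂ) * ψ x) := by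
  have h1 : HasFDerivAt (fun x : E d => ((φ x : ℝ) : ℂ)) (ofRealCLM ∘L fderiv ℝ φ x) x :=
    ofRealCLM.hasFDerivAt.comp x (φ.differentiableAt.hasFDerivAt)
  have h2 := ((h1.const_mul I).cexp).mul (hψ.1.differentiable (by simp) x).hasFDerivAt
  rw [show mulPhase φ ψ = (fun x => cexp (I * ((φ x : ℝ) : ℂ))) * ψ from rfl, h2.fderiv]
  simp
  ring

/-- Testing $e^{i\varphi}u$ with $\psi$ is testing $u$ with $e^{i\varphi}\psi$. Differentiating the
phase produces the extra term $-\partial_j\varphi\,\psi$. -/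
theorem IsMagDeriv.phaseOp {A : E d → E d} {j : Fin d} {u v : L2 d} (h : IsMagDeriv A j u v)
    (φ : 𝓢(E d, ℝ)) :
    IsMagDeriv (gauge A φ) j (MagRel.phaseOp φ u) (MagRel.phaseOp φ v) := by
  intro ψ hψ
  obtain ⟨h1, h2⟩ := h _ (hψ.mulPhase φ)
  have e1 : (fun x => u x * (I * fderiv ℝ (MagRel.mulPhase φ ψ) x (EuclideanSpace.single j 1) -
      ((A x j : ℝ) : ℂ) * MagRel.mulPhase φ ψ x)) =ᵐ[volume]
      fun x => MagRel.phaseOp φ u x * (I * fderiv ℝ ψ x (EuclideanSpace.single j 1) -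
      ((gauge A φ x j : ℝ) : ℂ) * ψ x) := by
    filter_upwards [coeFn_phaseOp φ u] with x hx
    rw [hx, fderiv_mulPhase φ hψ, MagRel.mulPhase, MagRel.mulPhase, gauge, PiLp.add_apply,
      gradient_apply]
    push_cast
    linear_combination (cexp (I * ((φ x : ℝ) : ℂ)) * u x *
      ((fderiv ℝ φ x (EuclideanSpace.single j 1) : ℝ) : ℂ) * ψ x) * I_mul_I
  have e2 : (fun x => v x * MagRel.mulPhase φ ψ x) =ᵐ[volume]
      fun x => MagRel.phaseOp φ v x * ψ x := by
    filter_upwards [coeFn_phaseOp φ v] with x hx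
    rw [hx, MagRel.mulPhase, MagRel.mulPhase]
    ring
  exact ⟨h1.congr e1, by rw [← integral_congr_ae e1, h2, integral_congr_ae e2]⟩

theorem gauge_gauge_neg (A : E d → E d) (φ : 𝓢(E d, ℝ)) : gauge (gauge A φ) (-φ) = A := by
  funext x
  ext j
  simp only [gauge, PiLp.add_apply, gradient_apply]
  rw [show ((-φ : 𝓢(E d, ℝ)) : E d → ℝ) = -(φ : E d → ℝ) from rfl, fderiv_neg]
  simp

theorem mem_magGraph_gauge_of_mem {m : ℝ} {A : E d → E d} {u w : L2 d}
    (h : (u, w) ∈ magGraph m A) (φ : 𝓢(E d, ℝ)) :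
    (phaseOp φ u, phaseOp φ w) ∈ magGraph m (gauge A φ) := by
  obtain ⟨p, hp, h⟩ := h
  refine ⟨fun j => phaseOp φ (p j), fun j => (hp j).phaseOp φ, fun v q hq => ?_⟩
  have hq' : ∀ j, IsMagDeriv A j (phaseOp (-φ) v) (phaseOp (-φ) (q j)) := fun j => by
    have := (hq j).phaseOp (-φ)
    rwa [gauge_gauge_neg] at this
  have := h _ _ hq'
  simpa only [inner_phaseOp_left, neg_neg] using this

theorem mem_magGraph_gauge_iff {m : ℝ} {A : E d → E d} (φ : 𝓢(E d, ℝ)) (u w : L2 d) :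
    (u, w) ∈ magGraph m (gauge A φ) ↔ (phaseOp (-φ) u, phaseOp (-φ) w) ∈ magGraph m A := by
  constructor
  · intro h
    have := mem_magGraph_gauge_of_mem h (-φ)
    rwa [gauge_gauge_neg] at this
  · intro h
    have := mem_magGraph_gauge_of_mem h φ
    rwa [phaseOp_apply_neg, phaseOp_apply_neg] at this

theorem mem_gaugeConj_graph (φ : 𝓢(E d, ℝ)) (S : L2 d →ₗ.[ℂ] L2 d) (u v : L2 d) :
    (u, v) ∈ (gaugeConj φ S).graph ↔ (phaseOp (-φ) u, phaseOp (-φ) v) ∈ S.graph := by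
  rw [LinearPMap.mem_graph_iff, LinearPMap.mem_graph_iff]
  constructor
  · rintro ⟨y, rfl, rfl⟩
    refine ⟨⟨phaseOp (-φ) y, y.2⟩, rfl, ?_⟩
    change _ = phaseOp (-φ) (phaseOp φ _)
    rw [phaseOp_neg_apply]
    rfl
  · rintro ⟨y, h1, h2⟩
    simp only at h1 h2
    have hu : u ∈ (gaugeConj φ S).domain := by
      change phaseOp (-φ) u ∈ S.domain
      rw [← h1]
      exact y.2
    refine ⟨⟨u, hu⟩, rfl, ?_⟩
    change phaseOp φ (S ⟨phaseOp (-φ) u, hu⟩) = v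
    rw [show (⟨phaseOp (-φ) u, hu⟩ : S.domain) = y from Subtype.ext h1.symm]
    rw [h2, phaseOp_apply_neg]

theorem continuous_phaseOp (φ : 𝓢(E d, ℝ)) : Continuous (phaseOp φ) := by
  refine AddMonoidHomClass.continuous_of_bound (phaseOp φ) 1 fun u => ?_
  rw [one_mul, @norm_eq_sqrt_re_inner ℂ, inner_phaseOp, ← @norm_eq_sqrt_re_inner ℂ]

theorem IsNonnegSqrt.gaugeConj {m : ℝ} {A : E d → E d} {S : L2 d →ₗ.[ℂ] L2 d}
    (h : IsNonnegSqrt S (magGraph m A)) (φ : 𝓢(E d, ℝ)) :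
    IsNonnegSqrt (MagRel.gaugeConj φ S) (magGraph m (gauge A φ)) := by
  obtain ⟨hd, hs, hp, hg⟩ := h
  have hd' : Dense ((MagRel.gaugeConj φ S).domain : Set (L2 d)) := by
    have hr : DenseRange (phaseOp φ) :=
      (show Function.Surjective (phaseOp φ) from fun u => ⟨_, phaseOp_apply_neg φ u⟩).denseRange
    refine (hr.dense_image (continuous_phaseOp φ) hd).mono ?_
    rintro _ ⟨v, hv, rfl⟩
    change phaseOp (-φ) (phaseOp φ v) ∈ S.domain
    rwa [phaseOp_neg_apply]
  refine ⟨hd', ?_, ?_, ?_⟩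
  · rw [isSelfAdjoint_iff_graph hd']
    intro x y
    rw [mem_gaugeConj_graph, (isSelfAdjoint_iff_graph hd).1 hs]
    constructor
    · intro h a b hab
      rw [mem_gaugeConj_graph] at hab
      have := h _ _ hab
      rwa [inner_phaseOp, inner_phaseOp] at this
    · intro h a b hab
      have := h (phaseOp φ a) (phaseOp φ b) (by
        rwa [mem_gaugeConj_graph, phaseOp_neg_apply, phaseOp_neg_apply])
      rwa [inner_phaseOp_left, inner_phaseOp_left] at this
  · intro u
    have hu := (mem_gaugeConj_graph φ S _ _).1 ((MagRel.gaugeConj φ S).mem_graph u)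
    rw [LinearPMap.mem_graph_iff] at hu
    obtain ⟨y, h1, h2⟩ := hu
    have := hp y
    simp only at h1 h2
    rwa [h1, h2, inner_phaseOp] at this
  · intro u w
    rw [mem_magGraph_gauge_iff, hg]
    simp only [mem_gaugeConj_graph]
    constructor
    · rintro ⟨v, h1, h2⟩
      exact ⟨phaseOp φ v, by rwa [phaseOp_neg_apply], by rwa [phaseOp_neg_apply]⟩
    · rintro ⟨v, h1, h2⟩
      exact ⟨_, h1, h2⟩

theorem contDiff_gradient (φ : 𝓢(E d, ℝ)) :
    ContDiff ℝ ∞ fun x => gradient (fun z => φ z) x :=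
  (InnerProductSpace.toDual ℝ (E d)).symm.contDiff.comp
    ((φ.smooth ⊤).fderiv_right (m := ∞) (by simp))

theorem IsL2Loc.gauge {A : E d → E d} (hA : IsL2Loc A) (φ : 𝓢(E d, ℝ)) :
    IsL2Loc (MagRel.gauge A φ) := fun K hK => by
  refine (hA K hK).add ?_
  have hc := (contDiff_gradient φ).continuous
  obtain ⟨C, hC⟩ := hK.exists_bound_of_continuousOn hc.continuousOn
  have : IsFiniteMeasure ((volume : Measure (E d)).restrict K) := ⟨by
    simpa using hK.measure_lt_top⟩
  exact MemLp.of_bound hc.aestronglyMeasurable C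
    ((ae_restrict_iff' hK.measurableSet).2 (ae_of_all _ hC))

/-- Both sides are nonnegative selfadjoint square roots of the same operator. -/
theorem H3_gauge (m : ℝ) {A : E d → E d} (hA : IsL2Loc A) (φ : 𝓢(E d, ℝ)) :
    H3 m (gauge A φ) = gaugeConj φ (H3 m A) := by
  have h1 : IsNonnegSqrt (H3 m A) (magGraph m A) :=
    Classical.epsilon_spec (existsUnique_isNonnegSqrt m hA).exists
  have h2 : IsNonnegSqrt (H3 m (gauge A φ)) (magGraph m (gauge A φ)) :=
    Classical.epsilon_spec (existsUnique_isNonnegSqrt m (hA.gauge φ)).exists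
  exact (existsUnique_isNonnegSqrt m (hA.gauge φ)).unique h2 (h1.gaugeConj φ)

/-! ### Oscillatory integrals with a gauge-shifted square root -/

/-- `∫ e^{-i y·ζ} g(y) dy`. -/
def fourierAt (g : E d → ℂ) (ζ : E d) : ℂ :=
  ∫ y, cexp (-I * ((⟪y, ζ⟫_ℝ : ℝ) : ℂ)) * g y

theorem fourierAt_eq (g : E d → ℂ) (ζ : E d) :
    fourierAt g ζ = FourierTransform.fourier g ((2 * Real.pi)⁻¹ • ζ) := by
  rw [Real.fourier_eq', fourierAt]
  refine integral_congr_ae (ae_of_all _ fun y => ?_)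
  simp only [smul_eq_mul]
  congr 2
  rw [inner_smul_right]
  have : (-2 * Real.pi * ((2 * Real.pi)⁻¹ * ⟪y, ζ⟫_ℝ)) = -⟪y, ζ⟫_ℝ := by
    field_simp
  rw [this]
  push_cast
  ring

theorem norm_cexp_neg_I_mul (t : ℝ) : ‖cexp (-I * (t : ℂ))‖ = 1 := by
  rw [neg_mul, mul_comm, ← neg_mul, ← ofReal_neg, Complex.norm_exp_ofReal_mul_I]

/-- Decay of the Fourier transform, uniform over functions with uniform bounds on their
derivatives and supported in one compact set. -/
theorem exists_fourierAt_decay {K : Set (E d)} (hK : IsCompact K) (N : ℕ) (C : ℝ) :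
    ∃ M : ℝ, ∀ G : E d → ℂ, ContDiff ℝ ∞ G → tsupport G ⊆ K →
      (∀ n ≤ N, ∀ y, ‖iteratedFDeriv ℝ n G y‖ ≤ C) →
      ∀ ζ, ‖fourierAt G ζ‖ ≤ M * ((1 + ‖ζ‖) ^ N)⁻¹ := by
  set V : ℝ := C * volume.real K with hV
  -- `V` bounds the $L^1$ norms of the derivatives of `G`, and $2^N(N+1)V$ bounds $|w|^N|\hat
  -- G(w)|$. The factor $(2\pi)^N$ comes from $w=\zeta/2\pi$, the outer $2^N$ from
  -- $(1+t)^N\le2^N(1+t^N)$.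
  refine ⟨2 ^ N * (V + (2 * Real.pi) ^ N * (2 ^ N * ((N + 1) * V))), fun G hG hGK hC ζ => ?_⟩
  have hsupp : ∀ n, HasCompactSupport (iteratedFDeriv ℝ n G) := fun n =>
    hK.of_isClosed_subset (isClosed_tsupport _) ((tsupport_iteratedFDeriv_subset n).trans hGK)
  have hint : ∀ n : ℕ, Integrable fun v => ‖v‖ ^ 0 * ‖iteratedFDeriv ℝ n G v‖ := fun n => by
    simp only [pow_zero, one_mul]
    exact ((hG.continuous_iteratedFDeriv (m := n)
      (by exact_mod_cast le_top)).integrable_of_hasCompactSupport (hsupp n)).norm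
  have hle : ∀ n ≤ N, ∫ v, ‖v‖ ^ 0 * ‖iteratedFDeriv ℝ n G v‖ ≤ V := fun n hn => by
    simp only [pow_zero, one_mul]
    rw [← setIntegral_eq_integral_of_forall_compl_eq_zero (s := K)]
    · refine (Real.le_norm_self _).trans ?_
      refine norm_setIntegral_le_of_norm_le_const hK.measure_lt_top fun x _ => ?_
      rw [norm_norm]
      exact hC n hn x
    · intro x hx
      rw [norm_eq_zero]
      exact image_eq_zero_of_notMem_tsupport
        fun h => hx (hGK (tsupport_iteratedFDeriv_subset n h))
  have hdec : ∀ n ≤ N, ∀ w : E d, ‖w‖ ^ n * ‖FourierTransform.fourier G w‖ ≤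
      2 ^ n * ((n + 1) * V) := fun n hn w => by
    have h := Real.pow_mul_norm_iteratedFDeriv_fourier_le (f := G) (K := 0) (N := ⊤) hG
      (fun k n hk _ => by
        obtain rfl : k = 0 := by simpa using hk
        exact hint n) (k := 0) (n := n) le_rfl le_top w
    rw [norm_iteratedFDeriv_zero] at h
    refine h.trans ?_
    simp only [pow_zero, Nat.cast_zero, mul_zero, zero_add, one_mul, Finset.range_one,
      Finset.sum_product, Finset.sum_singleton]
    gcongr
    refine (Finset.sum_le_card_nsmul _ _ V fun p hp => ?_).trans_eq (by simp)
    have := hle p (by have := Finset.mem_range.1 hp; omega)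
    simpa using this
  have h0 := hdec 0 (Nat.zero_le _) ((2 * Real.pi)⁻¹ • ζ)
  have h1 := hdec N le_rfl ((2 * Real.pi)⁻¹ • ζ)
  rw [← fourierAt_eq] at h0 h1
  simp only [pow_zero, one_mul, Nat.cast_zero, zero_add] at h0
  rw [norm_smul, Real.norm_eq_abs, abs_of_nonneg (by positivity), mul_pow, inv_pow, mul_assoc,
    inv_mul_le_iff₀ (by positivity)] at h1
  rw [← div_eq_mul_inv, le_div_iff₀ (by positivity)]
  have h2 : (1 + ‖ζ‖) ^ N ≤ 2 ^ N * (1 + ‖ζ‖ ^ N) := by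
    refine (add_pow_le zero_le_one (norm_nonneg ζ) N).trans ?_
    rw [one_pow]
    gcongr
    · norm_num
    · omega
  calc ‖fourierAt G ζ‖ * (1 + ‖ζ‖) ^ N ≤ ‖fourierAt G ζ‖ * (2 ^ N * (1 + ‖ζ‖ ^ N)) := by gcongr
    _ = 2 ^ N * (‖fourierAt G ζ‖ + ‖ζ‖ ^ N * ‖fourierAt G ζ‖) := by ring
    _ ≤ _ := by gcongr

/-- The cut-off amplitude has derivatives bounded uniformly in `ε` and `ζ`. -/
theorem exists_bound_iteratedFDeriv_cutoff {B : E d → E d} (hB : ContDiff ℝ ∞ B) {g : E d → ℂ}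
    (hg : IsTest g) (χ : 𝓢(E d × E d, ℂ)) (N : ℕ) :
    ∃ C : ℝ, ∀ ε : ℝ, 0 < ε → ε ≤ 1 → ∀ ζ : E d, ∀ n ≤ N, ∀ y,
      ‖iteratedFDeriv ℝ n (fun y => χ (ε • (ζ + B y), ε • y) * g y) y‖ ≤ C := by
  have hh : ContDiff ℝ ∞ fun y : E d => (B y, y) := hB.prodMk contDiff_id
  have hbd : ∀ n : ℕ, ∃ D : ℝ, ∀ y ∈ tsupport g,
      ‖iteratedFDeriv ℝ n (fun y : E d => (B y, y)) y‖ ≤ D := fun n =>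
    IsCompact.exists_bound_of_continuousOn hg.2
      (hh.continuous_iteratedFDeriv (m := n) (by exact_mod_cast le_top)).continuousOn
  choose D hD using hbd
  have hgb : ∀ n : ℕ, ∃ D : ℝ, ∀ y ∈ tsupport g, ‖iteratedFDeriv ℝ n g y‖ ≤ D := fun n =>
    IsCompact.exists_bound_of_continuousOn hg.2
      (hg.1.continuous_iteratedFDeriv (m := n) (by exact_mod_cast le_top)).continuousOn
  choose Q hQ using hgb
  have hχb : ∀ n : ℕ, ∃ D : ℝ, 0 < D ∧ ∀ p, ‖iteratedFDeriv ℝ n χ p‖ ≤ D := fun n => by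
    obtain ⟨D, h0, h⟩ := χ.decay 0 n
    exact ⟨D, h0, by simpa using h⟩
  choose P hP0 hP using hχb
  -- The summand $1$ ensures $D'\ge1$, so that $D'\le D'^k$ as the bound for iterated derivatives of
  -- a composition requires.
  set D' : ℝ := 1 + ∑ i ∈ Finset.range (N + 1), |D i| with hD'
  set P' : ℝ := ∑ i ∈ Finset.range (N + 1), P i with hP'
  set Q' : ℝ := ∑ i ∈ Finset.range (N + 1), |Q i| with hQ'
  have hD1 : 1 ≤ D' := by
    have : 0 ≤ ∑ i ∈ Finset.range (N + 1), |D i| := Finset.sum_nonneg fun _ _ => abs_nonneg _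
    linarith
  have hP'0 : 0 ≤ P' := Finset.sum_nonneg fun i _ => (hP0 i).le
  have hQ'0 : 0 ≤ Q' := Finset.sum_nonneg fun i _ => abs_nonneg _
  have hDi : ∀ i ≤ N, D i ≤ D' := fun i hi => by
    have := Finset.single_le_sum (f := fun i => |D i|) (fun _ _ => abs_nonneg _)
      (Finset.mem_range.2 (Nat.lt_succ_of_le hi))
    have := le_abs_self (D i)
    linarith
  have hPi : ∀ i ≤ N, P i ≤ P' := fun i hi =>
    Finset.single_le_sum (f := P) (fun i _ => (hP0 i).le)
      (Finset.mem_range.2 (Nat.lt_succ_of_le hi))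
  have hQi : ∀ i ≤ N, Q i ≤ Q' := fun i hi =>
    (le_abs_self _).trans (Finset.single_le_sum (f := fun i => |Q i|) (fun _ _ => abs_nonneg _)
      (Finset.mem_range.2 (Nat.lt_succ_of_le hi)))
  refine ⟨2 ^ N * (N.factorial * P' * D' ^ N * Q'), fun ε hε hε1 ζ n hn y => ?_⟩
  by_cases hy : y ∈ tsupport g
  swap
  · have hz : iteratedFDeriv ℝ n (fun y => χ (ε • (ζ + B y), ε • y) * g y) y = 0 :=
      image_eq_zero_of_notMem_tsupport fun h =>
        hy (tsupport_mul_subset_right (tsupport_iteratedFDeriv_subset n h))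
    rw [hz, norm_zero]
    positivity
  -- The frequency $\zeta$ enters only as an additive constant, so it disappears from all
  -- derivatives of `h`; hence the uniformity in $\zeta$.
  set h : E d → E d × E d := fun y => (ε • (ζ, (0 : E d))) + ε • (B y, y) with hdef
  have hhε : ContDiff ℝ ∞ fun y => ε • (B y, y) := hh.const_smul ε
  have hhs : ContDiff ℝ ∞ h := contDiff_const.add hhε
  have heq : (fun y => χ (ε • (ζ + B y), ε • y) * g y) = fun y => (χ ∘ h) y * g y := by
    funext y
    simp [hdef, smul_add]
  have hχs : ContDiff ℝ ∞ χ := χ.smooth ⊤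
  have hcomp : ∀ i ≤ n, ‖iteratedFDeriv ℝ i (χ ∘ h) y‖ ≤ N.factorial * P' * D' ^ N :=
      fun i hi => by
    have hiN := hi.trans hn
    refine (norm_iteratedFDeriv_comp_le (N := ∞) hχs hhs (by exact_mod_cast le_top) y
      (C := P') (D := D') (fun k hk => (hP k _).trans (hPi k (hk.trans hiN))) ?_).trans ?_
    · intro k hk1 hk
      have e1 : iteratedFDeriv ℝ k h y = ε • iteratedFDeriv ℝ k (fun y => (B y, y)) y := by
        rw [hdef, fun_iteratedFDeriv_add_apply contDiffAt_const
          (hhε.contDiffAt.of_le (by exact_mod_cast le_top)),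
          iteratedFDeriv_const_of_ne (by omega), Pi.zero_apply, zero_add]
        exact iteratedFDeriv_const_smul_apply' (a := ε)
          (hh.contDiffAt.of_le (by exact_mod_cast le_top))
      rw [e1, norm_smul, Real.norm_eq_abs, abs_of_pos hε]
      calc ε * ‖iteratedFDeriv ℝ k (fun y => (B y, y)) y‖
          ≤ 1 * D' := by
            gcongr
            exact (hD k y hy).trans (hDi k (hk.trans hiN))
        _ = D' ^ 1 := by ring
        _ ≤ D' ^ k := pow_le_pow_right₀ hD1 hk1
    · gcongr
  rw [heq]
  refine (norm_iteratedFDeriv_mul_le (N := ∞) (hχs.comp hhs) hg.1 y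
    (by exact_mod_cast le_top)).trans ?_
  calc ∑ i ∈ Finset.range (n + 1), (n.choose i : ℝ) * ‖iteratedFDeriv ℝ i (χ ∘ h) y‖ *
        ‖iteratedFDeriv ℝ (n - i) g y‖
      ≤ ∑ i ∈ Finset.range (n + 1), (n.choose i : ℝ) * (N.factorial * P' * D' ^ N) * Q' := by
        refine Finset.sum_le_sum fun i hi => ?_
        have hi' : i ≤ n := by have := Finset.mem_range.1 hi; omega
        gcongr
        · exact hcomp i hi'
        · exact (hQ _ y hy).trans (hQi _ (by omega))
    _ = (∑ i ∈ Finset.range (n + 1), (n.choose i : ℝ)) * (N.factorial * P' * D' ^ N * Q') := by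
        rw [Finset.sum_mul]
        exact Finset.sum_congr rfl fun i _ => by ring
    _ = 2 ^ n * (N.factorial * P' * D' ^ N * Q') := by
        rw [← Nat.cast_sum, Nat.sum_range_choose]
        push_cast
        rfl
    _ ≤ 2 ^ N * (N.factorial * P' * D' ^ N * Q') := by
        gcongr
        norm_num

/-- This is the substitution $\xi=\zeta+B(y)$ that removes the potential from the symbol. -/
theorem measurePreserving_shear {B : E d → E d} (hB : Continuous B) :
    MeasurePreserving (fun p : E d × E d => (p.1 + B p.2, p.2)) := by
  have h1 : MeasurePreserving (fun p : E d × E d => (p.1, p.2 + B p.1))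
      (volume.prod volume) (volume.prod volume) :=
    (MeasurePreserving.id volume).skew_product (g := fun a c => c + B a)
      (by fun_prop) (ae_of_all _ fun a => (measurePreserving_add_right volume (B a)).map_eq)
  have h2 : MeasurePreserving (Prod.swap : E d × E d → E d × E d)
      (volume.prod volume) (volume.prod volume) := Measure.measurePreserving_swap
  exact h2.comp (h1.comp h2)

theorem sqrt_sq_add_sq_le (a m : ℝ) (ha : 0 ≤ a) : √(a ^ 2 + m ^ 2) ≤ a + |m| := by
  rw [Real.sqrt_le_left (by positivity)]
  nlinarith [sq_abs m, abs_nonneg m]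

/-- The amplitude grows at most linearly because $B$ is bounded on the support of $F$; the Schwartz
cutoff absorbs this growth. -/
theorem integrable_cutoff_amplitude (m : ℝ) {B : E d → E d} (hB : Continuous B) {F : E d → ℂ}
    (hF : IsTest F) (χ : 𝓢(E d × E d, ℂ)) {ε : ℝ} (hε : 0 < ε) :
    Integrable (fun p : E d × E d => cexp (-I * ((⟪p.2, p.1⟫_ℝ : ℝ) : ℂ)) *
      χ (ε • p.1, ε • p.2) * ((√(‖p.1 - B p.2‖ ^ 2 + m ^ 2) : ℝ) * F p.2)) := by
  have hvol : (volume : Measure (E d × E d)).IsAddHaarMeasure := by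
    rw [Measure.volume_eq_prod]
    infer_instance
  have hχc := χ.continuous
  have hFc := hF.1.continuous
  obtain ⟨C₂, hC₂⟩ := hF.2.exists_bound_of_continuous hFc
  obtain ⟨C₁, hC₁⟩ := (hF.2.smul_left (f := fun y => ‖B y‖)).exists_bound_of_continuous
    (by fun_prop)
  have i0 : Integrable fun p : E d × E d => ‖χ (ε • p)‖ :=
    (χ.integrable.comp_smul hε.ne').norm
  have i1 : Integrable fun p : E d × E d => ‖p‖ * ‖χ (ε • p)‖ := by
    have := ((χ.integrable_pow_mul volume 1).comp_smul hε.ne').const_mul ε⁻¹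
    refine this.congr (ae_of_all _ fun p => ?_)
    simp only [pow_one, norm_smul, Real.norm_eq_abs, abs_of_pos hε]
    field_simp
  refine ((i1.const_mul C₂).add (i0.const_mul (|m| * C₂ + C₁))).mono'
    (by fun_prop) (ae_of_all _ fun p => ?_)
  have h1 : √(‖p.1 - B p.2‖ ^ 2 + m ^ 2) ≤ ‖p‖ + ‖B p.2‖ + |m| := by
    refine (sqrt_sq_add_sq_le _ _ (norm_nonneg _)).trans ?_
    have := norm_sub_le p.1 (B p.2)
    have := norm_fst_le p
    linarith
  have h2 : ‖B p.2‖ * ‖F p.2‖ ≤ C₁ := by simpa [norm_smul] using hC₁ p.2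
  have h3 : √(‖p.1 - B p.2‖ ^ 2 + m ^ 2) * ‖F p.2‖ ≤ ‖p‖ * C₂ + (|m| * C₂ + C₁) := by
    calc _ ≤ (‖p‖ + ‖B p.2‖ + |m|) * ‖F p.2‖ := by gcongr
      _ = ‖p‖ * ‖F p.2‖ + |m| * ‖F p.2‖ + ‖B p.2‖ * ‖F p.2‖ := by ring
      _ ≤ ‖p‖ * C₂ + |m| * C₂ + C₁ := by gcongr <;> exact hC₂ _
      _ = _ := by ring
  rw [norm_mul, norm_mul, norm_mul, norm_cexp_neg_I_mul, one_mul, norm_real, Real.norm_eq_abs,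
    abs_of_nonneg (Real.sqrt_nonneg _)]
  calc ‖χ (ε • p.1, ε • p.2)‖ * (√(‖p.1 - B p.2‖ ^ 2 + m ^ 2) * ‖F p.2‖)
      ≤ ‖χ (ε • p.1, ε • p.2)‖ * (‖p‖ * C₂ + (|m| * C₂ + C₁)) := by gcongr
    _ = C₂ * (‖p‖ * ‖χ (ε • p)‖) + (|m| * C₂ + C₁) * ‖χ (ε • p)‖ := by
      rw [show ε • p = (ε • p.1, ε • p.2) from rfl]; ring

/-- The test function `e^{-i y·B(y)} F(y)`. -/
def twist (B : E d → E d) (F : E d → ℂ) : E d → ℂ :=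
  fun y => cexp (-I * ((⟪y, B y⟫_ℝ : ℝ) : ℂ)) * F y

theorem IsTest.twist {B : E d → E d} (hB : ContDiff ℝ ∞ B) {F : E d → ℂ} (hF : IsTest F) :
    IsTest (MagRel.twist B F) :=
  hF.mul_left ((contDiff_const.mul
    (ofRealCLM.contDiff.comp (contDiff_id.inner ℝ hB))).cexp)

theorem integral_cutoff_amplitude (m : ℝ) {B : E d → E d} (hB : Continuous B) {F : E d → ℂ}
    (hF : IsTest F) (χ : 𝓢(E d × E d, ℂ)) {ε : ℝ} (hε : 0 < ε) :
    ∫ p : E d × E d, cexp (-I * ((⟪p.2, p.1⟫_ℝ : ℝ) : ℂ)) *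
      χ (ε • p.1, ε • p.2) * ((√(‖p.1 - B p.2‖ ^ 2 + m ^ 2) : ℝ) * F p.2) =
    ∫ ζ : E d, (√(‖ζ‖ ^ 2 + m ^ 2) : ℝ) *
      fourierAt (fun y => χ (ε • (ζ + B y), ε • y) * twist B F y) ζ := by
  have hi := integrable_cutoff_amplitude m hB hF χ hε
  have hΦ := measurePreserving_shear hB
  have hi' := hΦ.integrable_comp_of_integrable hi
  have e := integral_map (μ := volume) hΦ.aemeasurable (hΦ.map_eq.symm ▸ hi.aestronglyMeasurable)
  rw [hΦ.map_eq] at e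
  rw [e, Measure.volume_eq_prod]
  refine (integral_prod _ hi').trans ?_
  refine integral_congr_ae (ae_of_all _ fun ζ => ?_)
  simp only [fourierAt]
  rw [← integral_const_mul]
  refine integral_congr_ae (ae_of_all _ fun y => ?_)
  simp only [Function.comp, add_sub_cancel_right, twist, inner_add_right]
  rw [ofReal_add, mul_add, Complex.exp_add]
  ring

/-- Of the $d+2$ powers of decay, one pays for the growth of the symbol and $d+1$ for integrability
on $\mathbb R^d$. -/
theorem integrable_sqrt_mul_decay (m M : ℝ) :
    Integrable fun ζ : E d => √(‖ζ‖ ^ 2 + m ^ 2) * (M * ((1 + ‖ζ‖) ^ (d + 2))⁻¹) := by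
  have h : Integrable fun ζ : E d => (1 + ‖ζ‖) ^ (-((d + 1 : ℕ) : ℝ)) :=
    integrable_one_add_norm (by simp)
  refine (h.const_mul ((1 + |m|) * |M|)).mono' ?_ (ae_of_all _ fun ζ => ?_)
  · have hc : Continuous fun ζ : E d => √(‖ζ‖ ^ 2 + m ^ 2) * (M * ((1 + ‖ζ‖) ^ (d + 2))⁻¹) := by
      refine Continuous.mul (by fun_prop) (continuous_const.mul (Continuous.inv₀ (by fun_prop) ?_))
      intro x; positivity
    exact hc.aestronglyMeasurable
  · have h1 : √(‖ζ‖ ^ 2 + m ^ 2) ≤ (1 + |m|) * (1 + ‖ζ‖) := by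
      refine (sqrt_sq_add_sq_le _ _ (norm_nonneg _)).trans ?_
      nlinarith [abs_nonneg m, norm_nonneg ζ, mul_nonneg (abs_nonneg m) (norm_nonneg ζ)]
    rw [Real.rpow_neg (by positivity), Real.rpow_natCast, norm_mul, norm_mul, Real.norm_eq_abs,
      Real.norm_eq_abs, Real.norm_eq_abs, abs_of_nonneg (Real.sqrt_nonneg _),
      abs_of_nonneg (by positivity : 0 ≤ ((1 + ‖ζ‖) ^ (d + 2))⁻¹)]
    calc √(‖ζ‖ ^ 2 + m ^ 2) * (|M| * ((1 + ‖ζ‖) ^ (d + 2))⁻¹)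
        ≤ ((1 + |m|) * (1 + ‖ζ‖)) * (|M| * ((1 + ‖ζ‖) ^ (d + 2))⁻¹) := by gcongr
      _ = (1 + |m|) * |M| * ((1 + ‖ζ‖) ^ (d + 1))⁻¹ := by
        rw [pow_succ (1 + ‖ζ‖) (d + 1)]
        field_simp

/-- After the shear and Fubini, the inner $y$-integral is a Fourier transform that decays in $\zeta$
uniformly for $0<\varepsilon\le1$. Dominated convergence, in $y$ and then in $\zeta$, removes the
cutoff. -/
theorem hasOscIntegral_sqrt (m : ℝ) {B : E d → E d} (hB : ContDiff ℝ ∞ B) {F : E d → ℂ}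
    (hF : IsTest F) :
    HasOscIntegral (fun ξ y => ((√(‖ξ - B y‖ ^ 2 + m ^ 2) : ℝ) : ℂ) * F y)
      (∫ ζ : E d, ((√(‖ζ‖ ^ 2 + m ^ 2) : ℝ) : ℂ) * fourierAt (twist B F) ζ) := by
  intro χ hχ
  refine ⟨fun ε hε => integrable_cutoff_amplitude m hB.continuous hF χ hε, ?_⟩
  have hg := hF.twist hB
  set g := twist B F with hgdef
  obtain ⟨C, hC⟩ := exists_bound_iteratedFDeriv_cutoff hB hg χ (d + 2)
  obtain ⟨M, hM⟩ := exists_fourierAt_decay (d := d) hg.2 (d + 2) C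
  have hBc := hB.continuous
  have hgc := hg.1.continuous
  have hχc := χ.continuous
  have key : Tendsto (fun ε : ℝ => ∫ ζ : E d, ((√(‖ζ‖ ^ 2 + m ^ 2) : ℝ) : ℂ) *
      fourierAt (fun y => χ (ε • (ζ + B y), ε • y) * g y) ζ) (𝓝[>] 0)
      (𝓝 (∫ ζ : E d, ((√(‖ζ‖ ^ 2 + m ^ 2) : ℝ) : ℂ) * fourierAt g ζ)) := by
    refine tendsto_integral_filter_of_dominated_convergence _ ?_ ?_
      (integrable_sqrt_mul_decay m M) ?_
    · refine Eventually.of_forall fun ε => ?_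
      refine AEStronglyMeasurable.mul (by fun_prop) ?_
      have : Continuous fun p : E d × E d => cexp (-I * ((⟪p.2, p.1⟫_ℝ : ℝ) : ℂ)) *
          (χ (ε • (p.1 + B p.2), ε • p.2) * g p.2) := by fun_prop
      exact (this.stronglyMeasurable.integral_prod_right').aestronglyMeasurable
    · filter_upwards [Ioc_mem_nhdsGT (zero_lt_one' ℝ)] with ε hε
      refine ae_of_all _ fun ζ => ?_
      rw [norm_mul, norm_real, Real.norm_eq_abs, abs_of_nonneg (Real.sqrt_nonneg _)]
      gcongr
      refine hM _ ?_ ?_ (hC ε hε.1 hε.2 ζ) ζ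
      · have hχs := χ.smooth ⊤
        have hgs := hg.1
        fun_prop
      · exact tsupport_mul_subset_right
    · refine ae_of_all _ fun ζ => Tendsto.const_mul _ ?_
      obtain ⟨D, hD⟩ := χ.decay 0 0
      refine tendsto_integral_filter_of_dominated_convergence (fun y => D * ‖g y‖)
        (Eventually.of_forall fun ε => by fun_prop) ?_ ?_ ?_
      · refine Eventually.of_forall fun ε => ae_of_all _ fun y => ?_
        rw [norm_mul, norm_mul, norm_cexp_neg_I_mul, one_mul]
        gcongr
        simpa using hD.2 (ε • (ζ + B y), ε • y)
      · exact ((hgc.integrable_of_hasCompactSupport hg.2).norm).const_mul D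
      · refine ae_of_all _ fun y => ?_
        have hc : Continuous fun ε : ℝ => cexp (-I * ((⟪y, ζ⟫_ℝ : ℝ) : ℂ)) *
            (χ (ε • (ζ + B y), ε • y) * g y) := by fun_prop
        have := (hc.tendsto 0).mono_left (nhdsWithin_le_nhds (s := Set.Ioi 0))
        simpa [hχ] using this
  refine key.congr' ?_
  filter_upwards [self_mem_nhdsWithin] with ε hε
  exact (integral_cutoff_amplitude m hB.continuous hF χ hε).symm

/-! ### Smoothness of the averaged potential -/

section Parametric

variable {V : Type} [NormedAddCommGroup V] [NormedSpace ℝ V] [ProperSpace V]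

theorem hasFDerivAt_intervalIntegral_of_contDiff {W : Type} [NormedAddCommGroup W]
    [NormedSpace ℝ W] [CompleteSpace W] {F : V × ℝ → W} (hF : ContDiff ℝ ∞ F) (y₀ : V) :
    HasFDerivAt (fun y => ∫ θ in (0 : ℝ)..1, F (y, θ))
      (∫ θ in (0 : ℝ)..1, (fderiv ℝ F (y₀, θ)).comp (ContinuousLinearMap.inl ℝ V ℝ)) y₀ := by
  have hF' : Continuous fun p => fderiv ℝ F p := hF.continuous_fderiv (by simp)
  have hFc := hF.continuous
  have hG : Continuous fun p : V × ℝ =>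
      (fderiv ℝ F p).comp (ContinuousLinearMap.inl ℝ V ℝ) := by fun_prop
  obtain ⟨C, hC⟩ := ((isCompact_closedBall y₀ 1).prod
    (isCompact_Icc (a := (0 : ℝ)) (b := 1))).exists_bound_of_continuousOn hG.continuousOn
  refine (intervalIntegral.hasFDerivAt_integral_of_dominated_of_fderiv_le
    (F := fun y θ => F (y, θ)) (bound := fun _ => C)
    (F' := fun y θ => (fderiv ℝ F (y, θ)).comp (ContinuousLinearMap.inl ℝ V ℝ))
    (Metric.ball_mem_nhds y₀ one_pos) ?_ ?_ ?_ ?_ ?_ ?_)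
  · exact Eventually.of_forall fun y =>
      (by fun_prop : Continuous fun θ : ℝ => F (y, θ)).aestronglyMeasurable
  · exact (by fun_prop : Continuous fun θ : ℝ => F (y₀, θ)).intervalIntegrable _ _
  · exact (by fun_prop : Continuous fun θ : ℝ =>
      (fderiv ℝ F (y₀, θ)).comp (ContinuousLinearMap.inl ℝ V ℝ)).aestronglyMeasurable
  · refine ae_of_all _ fun θ hθ y hy => hC (y, θ) ⟨Metric.ball_subset_closedBall hy, ?_⟩
    rw [Set.uIoc_of_le zero_le_one] at hθ
    exact ⟨hθ.1.le, hθ.2⟩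
  · exact intervalIntegrable_const
  · refine ae_of_all _ fun θ _ y _ => ?_
    have h1 := (hF.differentiable (by simp) (y, θ)).hasFDerivAt
    exact h1.comp y (hasFDerivAt_prodMk_left y θ)

theorem contDiff_intervalIntegral {W : Type} [NormedAddCommGroup W] [NormedSpace ℝ W]
    [CompleteSpace W] {F : V × ℝ → W} (hF : ContDiff ℝ ∞ F) :
    ContDiff ℝ ∞ fun y => ∫ θ in (0 : ℝ)..1, F (y, θ) := by
  -- The target space must vary in the induction: the derivative takes values in continuous linear
  -- maps $V\to W$.
  have key : ∀ (n : ℕ) (W : Type) [NormedAddCommGroup W] [NormedSpace ℝ W] [CompleteSpace W]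
      (F : V × ℝ → W), ContDiff ℝ ∞ F →
        ContDiff ℝ n fun y => ∫ θ in (0 : ℝ)..1, F (y, θ) := by
    intro n
    induction n with
    | zero =>
      intro W _ _ _ F hF
      exact contDiff_zero.2 (continuous_iff_continuousAt.2 fun y =>
        (hasFDerivAt_intervalIntegral_of_contDiff hF y).continuousAt)
    | succ n ih =>
      intro W _ _ _ F hF
      refine contDiff_succ_iff_hasFDerivAt.2 ⟨_, ?_, hasFDerivAt_intervalIntegral_of_contDiff hF⟩
      exact ih _ (fun p => (fderiv ℝ F p).comp (ContinuousLinearMap.inl ℝ V ℝ))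
        ((hF.fderiv_right (m := ∞) (by simp)).clm_comp contDiff_const)
  exact contDiff_infty.2 fun n => key n W F hF

end Parametric

theorem contDiff_avgA {A : E d → E d} (hA : ContDiff ℝ ∞ A) (x : E d) :
    ContDiff ℝ ∞ fun y => avgA A x (x + y) := by
  refine contDiff_intervalIntegral (F := fun p : E d × ℝ =>
    A ((1 - p.2) • x + p.2 • (x + p.1))) (hA.comp ?_)
  fun_prop

theorem contDiff_midA {A : E d → E d} (hA : ContDiff ℝ ∞ A) (x : E d) :
    ContDiff ℝ ∞ fun y => midA A x (x + y) := by
  refine hA.comp ?_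
  fun_prop

theorem contDiff_gauge {A : E d → E d} (hA : ContDiff ℝ ∞ A) (φ : 𝓢(E d, ℝ)) :
    ContDiff ℝ ∞ (gauge A φ) :=
  hA.add (contDiff_gradient φ)

/-! ### The value of the oscillatory integrals -/

theorem IsTest.translate {f : E d → ℂ} (hf : IsTest f) (x : E d) : IsTest fun y => f (x + y) :=
  ⟨hf.1.comp (contDiff_const.add contDiff_id),
    hf.2.comp_homeomorph (Homeomorph.addLeft x)⟩

/-- The value at the origin of `(2π)^d √(-Δ + m²) g`. -/
def sqrtSymbolAtZero (m : ℝ) (g : E d → ℂ) : ℂ :=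
  ∫ ζ : E d, ((√(‖ζ‖ ^ 2 + m ^ 2) : ℝ) : ℂ) * fourierAt g ζ

theorem hasOscIntegral_amplitude (m : ℝ) {B : E d → E d → E d} {x : E d}
    (hB : ContDiff ℝ ∞ fun y => B x (x + y)) {f : E d → ℂ} (hf : IsTest f) :
    HasOscIntegral (amplitude m B f x)
      (sqrtSymbolAtZero m (twist (fun y => B x (x + y)) fun y => f (x + y))) :=
  hasOscIntegral_sqrt m hB (hf.translate x)

/-- The value is pinned down because an admissible cutoff exists, namely a smooth bump. -/
theorem HasOscIntegral.unique {a : E d → E d → ℂ} {L L' : ℂ} (h : HasOscIntegral a L)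
    (h' : HasOscIntegral a L') : L = L' := by
  let b : ContDiffBump (0 : E d × E d) := ⟨1, 2, one_pos, one_lt_two⟩
  have hb : HasCompactSupport fun p => ((b p : ℝ) : ℂ) :=
    b.hasCompactSupport.comp_left (g := fun t : ℝ => (t : ℂ)) (by simp)
  let χ : 𝓢(E d × E d, ℂ) := hb.toSchwartzMap (ofRealCLM.contDiff.comp b.contDiff)
  have hχ : χ (0, 0) = 1 := by
    change ((b 0 : ℝ) : ℂ) = 1
    rw [b.one_of_mem_closedBall (Metric.mem_closedBall_self b.rIn_pos.le), ofReal_one]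
  exact tendsto_nhds_unique (h χ hχ).2 (h' χ hχ).2

theorem HasOscIntegral.oscIntegral_eq {a : E d → E d → ℂ} {L : ℂ} (h : HasOscIntegral a L) :
    oscIntegral a = L := by
  have hex : ∃ L, HasOscIntegral a L := ⟨L, h⟩
  rw [oscIntegral, dif_pos hex]
  exact hex.choose_spec.unique h

theorem pseudoDiff_eq (m : ℝ) {B : E d → E d → E d} {x : E d}
    (hB : ContDiff ℝ ∞ fun y => B x (x + y)) {f : E d → ℂ} (hf : IsTest f) :
    pseudoDiff m B f x = (((2 * Real.pi) ^ d : ℝ) : ℂ)⁻¹ *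
      sqrtSymbolAtZero m (twist (fun y => B x (x + y)) fun y => f (x + y)) := by
  rw [pseudoDiff, (hasOscIntegral_amplitude m hB hf).oscIntegral_eq]

theorem fourierAt_const_mul (c : ℂ) (g : E d → ℂ) (ζ : E d) :
    fourierAt (fun y => c * g y) ζ = c * fourierAt g ζ := by
  simp only [fourierAt, mul_left_comm _ c, integral_const_mul]

theorem sqrtSymbolAtZero_const_mul (m : ℝ) (c : ℂ) (g : E d → ℂ) :
    sqrtSymbolAtZero m (fun y => c * g y) = c * sqrtSymbolAtZero m g := by
  simp only [sqrtSymbolAtZero, fourierAt_const_mul, mul_left_comm _ c, integral_const_mul]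

/-! ### Gauge covariance with the averaged potential -/

/-- Fundamental theorem of calculus for $\varphi$ along the segment from $x$ to $x+y$. -/
theorem inner_avgA_gauge {A : E d → E d} (hA : ContDiff ℝ ∞ A) (φ : 𝓢(E d, ℝ)) (x y : E d) :
    ⟪y, avgA (gauge A φ) x (x + y)⟫_ℝ = ⟪y, avgA A x (x + y)⟫_ℝ + (φ (x + y) - φ x) := by
  have hline : Continuous fun θ : ℝ => (1 - θ) • x + θ • (x + y) := by fun_prop
  have hA' : Continuous fun θ : ℝ => A ((1 - θ) • x + θ • (x + y)) := hA.continuous.comp hline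
  have hg : Continuous fun θ : ℝ =>
      gradient (fun z => φ z) ((1 - θ) • x + θ • (x + y)) :=
    (contDiff_gradient φ).continuous.comp hline
  have h1 : avgA (gauge A φ) x (x + y) = avgA A x (x + y) +
      ∫ θ in (0 : ℝ)..1, gradient (fun z => φ z) ((1 - θ) • x + θ • (x + y)) :=
    intervalIntegral.integral_add (hA'.intervalIntegrable _ _) (hg.intervalIntegrable _ _)
  have hderiv : ∀ θ : ℝ, HasDerivAt (fun θ : ℝ => φ ((1 - θ) • x + θ • (x + y)))
      ⟪y, gradient (fun z => φ z) ((1 - θ) • x + θ • (x + y))⟫_ℝ θ := by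
    intro θ
    have hl : HasDerivAt (fun θ : ℝ => (1 - θ) • x + θ • (x + y)) y θ := by
      have : (fun θ : ℝ => (1 - θ) • x + θ • (x + y)) = fun θ => x + θ • y := by
        funext θ; module
      rw [this]
      simpa using ((hasDerivAt_id θ).smul_const y).const_add x
    have := (φ.differentiableAt (x := (1 - θ) • x + θ • (x + y))).hasFDerivAt.comp_hasDerivAt θ hl
    rw [real_inner_comm, gradient, InnerProductSpace.toDual_symm_apply]
    exact this
  have h2 : ⟪y, ∫ θ in (0 : ℝ)..1, gradient (fun z => φ z) ((1 - θ) • x + θ • (x + y))⟫_ℝ =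
      φ (x + y) - φ x := by
    have e := (innerSL ℝ y).intervalIntegral_comp_comm (hg.intervalIntegrable (μ := volume) 0 1)
    simp only [innerSL_apply_apply] at e
    rw [← e, intervalIntegral.integral_eq_sub_of_hasDerivAt (fun θ _ => hderiv θ)
      ((continuous_const.inner hg).intervalIntegrable _ _)]
    simp
  rw [h1, inner_add_right, h2]

theorem H2_gauge (m : ℝ) {A : E d → E d} (hA : ContDiff ℝ ∞ A) (φ : 𝓢(E d, ℝ)) {f : E d → ℂ}
    (hf : IsTest f) : H2 m (gauge A φ) f = mulPhase φ (H2 m A (mulPhase (-φ) f)) := by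
  funext x
  rw [mulPhase, H2, H2, pseudoDiff_eq m (contDiff_avgA (contDiff_gauge hA φ) x) hf,
    pseudoDiff_eq m (contDiff_avgA hA x) (hf.mulPhase (-φ)), mul_left_comm,
    ← sqrtSymbolAtZero_const_mul m (cexp _)]
  congr 2
  funext y
  simp only [twist, mulPhase]
  rw [inner_avgA_gauge hA, ← mul_assoc, ← mul_assoc, ← Complex.exp_add, ← Complex.exp_add]
  congr 2
  simp
  ring

/-! ### Subordination: the square root as a superposition of exponentials -/

/-- `(1 - e^{-ts}) t^{-3/2}`. -/
def subKernel (s t : ℝ) : ℝ := (1 - Real.exp (-(t * s))) * t ^ (-(3 / 2) : ℝ)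

theorem subKernel_nonneg {s t : ℝ} (hs : 0 ≤ s) (ht : 0 ≤ t) : 0 ≤ subKernel s t := by
  refine mul_nonneg ?_ (Real.rpow_nonneg ht _)
  rw [sub_nonneg, Real.exp_le_one_iff]
  have := mul_nonneg ht hs
  linarith

theorem measurable_subKernel : Measurable fun p : ℝ × ℝ => subKernel p.1 p.2 := by
  unfold subKernel
  fun_prop

/-- The kernel is at most $t^{-1/2}$ near $0$ and at most $t^{-3/2}$ near infinity. -/
theorem integrableOn_subKernel_one : IntegrableOn (subKernel 1) (Set.Ioi 0) := by
  have hm : Measurable (subKernel 1) := by unfold subKernel; fun_prop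
  rw [← Set.Ioc_union_Ioi_eq_Ioi (zero_le_one' ℝ)]
  refine IntegrableOn.union ?_ ?_
  · have h : IntegrableOn (fun t : ℝ => t ^ (-(1 / 2) : ℝ)) (Set.Ioc 0 1) := by
      rw [← intervalIntegrable_iff_integrableOn_Ioc_of_le zero_le_one]
      exact intervalIntegral.intervalIntegrable_rpow' (by norm_num)
    refine Integrable.mono' h hm.aestronglyMeasurable ?_
    refine (ae_restrict_iff' measurableSet_Ioc).2 (ae_of_all _ fun t ht => ?_)
    rw [Real.norm_of_nonneg (subKernel_nonneg zero_le_one ht.1.le), subKernel]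
    have h1 : 1 - Real.exp (-(t * 1)) ≤ t := by
      have := Real.add_one_le_exp (-(t * 1)); linarith
    calc _ ≤ t * t ^ (-(3 / 2) : ℝ) :=
          mul_le_mul_of_nonneg_right h1 (Real.rpow_nonneg ht.1.le _)
      _ = t ^ (-(1 / 2) : ℝ) := by
          conv_lhs => enter [1]; rw [← Real.rpow_one t]
          rw [← Real.rpow_add ht.1]
          norm_num
  · have h : IntegrableOn (fun t : ℝ => t ^ (-(3 / 2) : ℝ)) (Set.Ioi 1) :=
      integrableOn_Ioi_rpow_of_lt (by norm_num) one_pos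
    refine Integrable.mono' h hm.aestronglyMeasurable ?_
    refine (ae_restrict_iff' measurableSet_Ioi).2 (ae_of_all _ fun t (ht : 1 < t) => ?_)
    have ht0 : 0 < t := one_pos.trans ht
    rw [Real.norm_of_nonneg (subKernel_nonneg zero_le_one ht0.le), subKernel]
    refine mul_le_of_le_one_left (Real.rpow_nonneg ht0.le _) ?_
    have := Real.exp_pos (-(t * 1))
    linarith

theorem subKernel_eq_scale {s t : ℝ} (hs : 0 < s) (ht : 0 < t) :
    subKernel s t = s ^ (3 / 2 : ℝ) * subKernel 1 (s * t) := by
  rw [subKernel, subKernel, Real.mul_rpow hs.le ht.le, Real.rpow_neg hs.le]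
  have : s ^ (3 / 2 : ℝ) ≠ 0 := (Real.rpow_pos_of_pos hs _).ne'
  field_simp

theorem integrableOn_subKernel {s : ℝ} (hs : 0 ≤ s) : IntegrableOn (subKernel s) (Set.Ioi 0) := by
  rcases hs.eq_or_lt with rfl | hs
  · have : subKernel 0 = fun _ => 0 := by funext t; simp [subKernel]
    rw [this]
    exact integrableOn_zero
  · have h : IntegrableOn (fun t => subKernel 1 (s * t)) (Set.Ioi 0) := by
      rw [integrableOn_Ioi_comp_mul_left_iff _ _ hs, mul_zero]
      exact integrableOn_subKernel_one
    exact IntegrableOn.congr_fun (h.const_mul (s ^ (3 / 2 : ℝ)))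
      (fun t ht => (subKernel_eq_scale hs ht).symm) measurableSet_Ioi

/-- Rescaling $t$ by $s$ yields $s^{3/2}s^{-1}=\sqrt s$. The value of the remaining constant plays
no role. -/
theorem integral_subKernel {s : ℝ} (hs : 0 ≤ s) :
    ∫ t in Set.Ioi 0, subKernel s t = √s * ∫ t in Set.Ioi 0, subKernel 1 t := by
  rcases hs.eq_or_lt with rfl | hs
  · simp [subKernel]
  · rw [setIntegral_congr_fun measurableSet_Ioi fun t ht => subKernel_eq_scale hs ht,
      integral_const_mul, integral_comp_mul_left_Ioi (subKernel 1) 0 hs, mul_zero, smul_eq_mul,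
      ← mul_assoc, Real.sqrt_eq_rpow]
    congr 1
    rw [← Real.rpow_neg_one s, ← Real.rpow_add hs]
    norm_num

/-! ### Nonlocality of `√(-Δ + m²)` -/

theorem IsTest.exists_fourierAt_le {g : E d → ℂ} (hg : IsTest g) :
    ∃ M : ℝ, ∀ ζ, ‖fourierAt g ζ‖ ≤ M * ((1 + ‖ζ‖) ^ (d + 2))⁻¹ := by
  have hb : ∀ n : ℕ, ∃ C : ℝ, ∀ y, ‖iteratedFDeriv ℝ n g y‖ ≤ C := fun n =>
    (hg.2.iteratedFDeriv (𝕜 := ℝ) n).exists_bound_of_continuous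
      (hg.1.continuous_iteratedFDeriv (m := n) (by exact_mod_cast le_top))
  choose C hC using hb
  obtain ⟨M, hM⟩ := exists_fourierAt_decay (d := d) hg.2 (d + 2)
    (∑ i ∈ Finset.range (d + 2 + 1), |C i|)
  refine ⟨M, hM g hg.1 le_rfl fun n hn y => ?_⟩
  exact ((hC n y).trans (le_abs_self _)).trans (Finset.single_le_sum (f := fun i => |C i|)
    (fun _ _ => abs_nonneg _) (Finset.mem_range.2 (Nat.lt_succ_of_le hn)))

theorem IsTest.continuous_fourierAt {g : E d → ℂ} (hg : IsTest g) : Continuous (fourierAt g) := by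
  refine continuous_of_dominated (bound := fun y => ‖g y‖) ?_ ?_ ?_ ?_
  · intro ζ
    have := hg.1.continuous
    exact (by fun_prop : Continuous fun y : E d =>
      cexp (-I * ((⟪y, ζ⟫_ℝ : ℝ) : ℂ)) * g y).aestronglyMeasurable
  · intro ζ
    refine ae_of_all _ fun y => ?_
    rw [norm_mul, norm_cexp_neg_I_mul, one_mul]
  · exact (hg.1.continuous.integrable_of_hasCompactSupport hg.2).norm
  · exact ae_of_all _ fun y => by fun_prop

theorem IsTest.integrable_sqrt_mul_fourierAt {g : E d → ℂ} (hg : IsTest g) (m : ℝ) :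
    Integrable fun ζ => √(‖ζ‖ ^ 2 + m ^ 2) * ‖fourierAt g ζ‖ := by
  obtain ⟨M, hM⟩ := hg.exists_fourierAt_le
  have hc := hg.continuous_fourierAt
  refine (integrable_sqrt_mul_decay m M).mono' ?_ (ae_of_all _ fun ζ => ?_)
  · exact (by fun_prop : Continuous fun ζ : E d =>
      √(‖ζ‖ ^ 2 + m ^ 2) * ‖fourierAt g ζ‖).aestronglyMeasurable
  · rw [norm_mul, norm_norm, Real.norm_of_nonneg (Real.sqrt_nonneg _)]
    gcongr
    exact hM ζ

theorem IsTest.integrable_fourierAt {g : E d → ℂ} (hg : IsTest g) : Integrable (fourierAt g) := by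
  refine (hg.integrable_sqrt_mul_fourierAt 1).mono' hg.continuous_fourierAt.aestronglyMeasurable
    (ae_of_all _ fun ζ => ?_)
  refine le_mul_of_one_le_left (norm_nonneg _) (Real.one_le_sqrt.2 ?_)
  nlinarith [sq_nonneg ‖ζ‖]

/-- Fourier inversion at the origin. -/
theorem IsTest.integral_fourierAt {g : E d → ℂ} (hg : IsTest g) (h0 : g 0 = 0) :
    ∫ ζ, fourierAt g ζ = 0 := by
  have hpi : (2 * Real.pi)⁻¹ ≠ 0 := by positivity
  have hi : Integrable (FourierTransform.fourier g) := by
    have := hg.integrable_fourierAt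
    simp only [funext (fourierAt_eq g)] at this
    exact (integrable_comp_smul_iff volume _ hpi).1 this
  have hinv := hg.1.continuous.fourierInv_fourier_eq
    (hg.1.continuous.integrable_of_hasCompactSupport hg.2) hi
  have h1 : ∫ w, FourierTransform.fourier g w = 0 := by
    have := congrFun hinv 0
    rw [Real.fourierInv_eq', h0] at this
    simpa using this
  simp only [fourierAt_eq]
  rw [Measure.integral_comp_smul, h1, smul_zero]

/-- Fubini moves the Fourier transform from $u$ to the Gaussian, giving a heat kernel, whose
positivity is what is needed later. -/
theorem integral_gaussian_mul_fourierAt {u : E d → ℝ} (hu : IsTest fun y => ((u y : ℝ) : ℂ))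
    {t : ℝ} (ht : 0 < t) :
    ∫ ζ : E d, ((Real.exp (-(t * ‖ζ‖ ^ 2)) : ℝ) : ℂ) * fourierAt (fun y => ((u y : ℝ) : ℂ)) ζ =
      ((∫ y, (Real.pi / t) ^ ((d : ℝ) / 2) * Real.exp (-(‖y‖ ^ 2 / (4 * t))) * u y : ℝ) : ℂ) := by
  have huc : Continuous u := continuous_re.comp hu.1.continuous
  have hui : Integrable fun y => ((u y : ℝ) : ℂ) :=
    hu.1.continuous.integrable_of_hasCompactSupport hu.2
  have hgauss : Integrable fun ζ : E d => ((Real.exp (-(t * ‖ζ‖ ^ 2)) : ℝ) : ℂ) := by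
    have := GaussianFourier.integrable_cexp_neg_mul_sq_norm_add (V := E d) (b := t)
      (by simpa using ht) 0 0
    refine this.congr (ae_of_all _ fun ζ => ?_)
    simp
  have hprod : Integrable (Function.uncurry fun (ζ y : E d) =>
      ((Real.exp (-(t * ‖ζ‖ ^ 2)) : ℝ) : ℂ) *
        (cexp (-I * ((⟪y, ζ⟫_ℝ : ℝ) : ℂ)) * ((u y : ℝ) : ℂ))) (volume.prod volume) := by
    refine (hgauss.mul_prod hui).mono (Continuous.aestronglyMeasurable ?_)
      (ae_of_all _ fun p => ?_)
    · simp only [Function.uncurry_def]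
      fun_prop
    · simp only [Function.uncurry_def, norm_mul, norm_cexp_neg_I_mul, one_mul, le_refl]
  simp only [fourierAt, ← integral_const_mul]
  rw [integral_integral_swap hprod, ← integral_complex_ofReal]
  refine integral_congr_ae (ae_of_all _ fun y => ?_)
  have hG := GaussianFourier.integral_cexp_neg_mul_sq_norm_add (V := E d) (b := t)
      (by simpa using ht) (-I) y
  have hpt : (((Real.pi / t) ^ ((d : ℝ) / 2) : ℝ) : ℂ) =
      ((Real.pi : ℂ) / t) ^ ((d : ℂ) / 2) := by
    rw [ofReal_cpow (by positivity)]
    push_cast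
    rfl
  calc ∫ ζ : E d, ((Real.exp (-(t * ‖ζ‖ ^ 2)) : ℝ) : ℂ) *
        (cexp (-I * ((⟪y, ζ⟫_ℝ : ℝ) : ℂ)) * ((u y : ℝ) : ℂ))
      = (∫ ζ : E d, cexp (-t * ‖ζ‖ ^ 2 + -I * ((⟪y, ζ⟫_ℝ : ℝ) : ℂ))) * ((u y : ℝ) : ℂ) := by
        rw [← integral_mul_const]
        refine integral_congr_ae (ae_of_all _ fun ζ => ?_)
        simp only
        rw [Complex.exp_add]
        push_cast
        ring_nf
    _ = _ := by
        rw [hG]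
        push_cast [hpt]
        simp only [finrank_euclideanSpace, Fintype.card_fin, neg_sq, I_sq]
        congr 3
        ring

theorem IsTest.integrable_subKernel_mul_fourierAt {g : E d → ℂ} (hg : IsTest g) (m : ℝ) :
    Integrable (Function.uncurry fun (ζ : E d) (t : ℝ) =>
      ((subKernel (‖ζ‖ ^ 2 + m ^ 2) t : ℝ) : ℂ) * fourierAt g ζ)
      (volume.prod (volume.restrict (Set.Ioi 0))) := by
  have hs : ∀ ζ : E d, 0 ≤ ‖ζ‖ ^ 2 + m ^ 2 := fun ζ => by positivity
  have hm : AEStronglyMeasurable (Function.uncurry fun (ζ : E d) (t : ℝ) =>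
      ((subKernel (‖ζ‖ ^ 2 + m ^ 2) t : ℝ) : ℂ) * fourierAt g ζ)
      (volume.prod (volume.restrict (Set.Ioi 0))) := by
    refine Measurable.aestronglyMeasurable ?_
    have h0 : Measurable fun p : E d × ℝ => ((‖p.1‖ ^ 2 + m ^ 2, p.2) : ℝ × ℝ) := by fun_prop
    exact (measurable_ofReal.comp (measurable_subKernel.comp h0)).mul
      (hg.continuous_fourierAt.measurable.comp measurable_fst)
  rw [integrable_prod_iff hm]
  constructor
  · refine ae_of_all _ fun ζ => ?_
    have h1 : Integrable (fun t => ((subKernel (‖ζ‖ ^ 2 + m ^ 2) t : ℝ) : ℂ))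
        (volume.restrict (Set.Ioi 0)) := (integrableOn_subKernel (hs ζ)).ofReal
    exact h1.mul_const (fourierAt g ζ)
  · refine ((hg.integrable_sqrt_mul_fourierAt m).const_mul
      (∫ t in Set.Ioi (0 : ℝ), subKernel 1 t)).congr (ae_of_all _ fun ζ => ?_)
    simp only [Function.uncurry_apply_pair, norm_mul]
    rw [integral_mul_const]
    have : ∫ t in Set.Ioi (0 : ℝ), ‖((subKernel (‖ζ‖ ^ 2 + m ^ 2) t : ℝ) : ℂ)‖ =
        √(‖ζ‖ ^ 2 + m ^ 2) * ∫ t in Set.Ioi (0 : ℝ), subKernel 1 t := by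
      rw [← integral_subKernel (hs ζ)]
      refine setIntegral_congr_fun measurableSet_Ioi fun t ht => ?_
      rw [norm_real, Real.norm_of_nonneg (subKernel_nonneg (hs ζ) (le_of_lt ht))]
    rw [this]
    ring

/-- The kernel of `√(-Δ + m²)` is strictly negative away from the diagonal. -/
theorem sqrtSymbolAtZero_ne_zero (m : ℝ) {u : E d → ℝ} (hu : IsTest fun y => ((u y : ℝ) : ℂ))
    (h0 : u 0 = 0) (hpos : ∀ y, 0 ≤ u y) (hne : u ≠ 0) :
    sqrtSymbolAtZero m (fun y => ((u y : ℝ) : ℂ)) ≠ 0 := by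
  set g : E d → ℂ := fun y => ((u y : ℝ) : ℂ) with hg
  have hg0 : g 0 = 0 := by simp [hg, h0]
  have hs : ∀ ζ : E d, 0 ≤ ‖ζ‖ ^ 2 + m ^ 2 := fun ζ => by positivity
  set c : ℝ := ∫ t in Set.Ioi (0 : ℝ), subKernel 1 t with hc
  have hfc := hu.continuous_fourierAt
  have huc : Continuous u := by
    have := continuous_re.comp hu.1.continuous
    exact this
  have hprod := hu.integrable_subKernel_mul_fourierAt m
  have hswap := integral_integral_swap hprod
  have hleft : ∫ ζ : E d, ∫ t in Set.Ioi (0 : ℝ),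
      ((subKernel (‖ζ‖ ^ 2 + m ^ 2) t : ℝ) : ℂ) * fourierAt g ζ =
      (c : ℂ) * sqrtSymbolAtZero m g := by
    rw [sqrtSymbolAtZero, ← integral_const_mul]
    refine integral_congr_ae (ae_of_all _ fun ζ => ?_)
    simp only
    rw [integral_mul_const, integral_complex_ofReal, integral_subKernel (hs ζ)]
    push_cast
    ring
  -- Because $\int\hat g=0$, the $1$ in $1-e^{-ts}$ contributes nothing. What remains is minus a
  -- positive weight times the heat kernel integrated against $u$.
  set q : ℝ → ℝ := fun t => t ^ (-(3 / 2) : ℝ) * (Real.exp (-(t * m ^ 2)) *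
    ∫ y, (Real.pi / t) ^ ((d : ℝ) / 2) * Real.exp (-(‖y‖ ^ 2 / (4 * t))) * u y) with hq
  have hright : ∀ t ∈ Set.Ioi (0 : ℝ), ∫ ζ : E d,
      ((subKernel (‖ζ‖ ^ 2 + m ^ 2) t : ℝ) : ℂ) * fourierAt g ζ = ((-q t : ℝ) : ℂ) := by
    intro t ht
    have hi := hu.integrable_fourierAt
    have hi2 : Integrable fun ζ : E d =>
        ((Real.exp (-(t * ‖ζ‖ ^ 2)) : ℝ) : ℂ) * fourierAt g ζ := by
      refine hi.mono (by fun_prop) (ae_of_all _ fun ζ => ?_)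
      rw [norm_mul, norm_real, Real.norm_of_nonneg (Real.exp_nonneg _)]
      refine mul_le_of_le_one_left (norm_nonneg _) (Real.exp_le_one_iff.2 ?_)
      have : 0 ≤ t * ‖ζ‖ ^ 2 := mul_nonneg (le_of_lt ht) (sq_nonneg _)
      linarith
    have e : ∀ ζ : E d, ((subKernel (‖ζ‖ ^ 2 + m ^ 2) t : ℝ) : ℂ) * fourierAt g ζ =
        ((t ^ (-(3 / 2) : ℝ) : ℝ) : ℂ) * (fourierAt g ζ - ((Real.exp (-(t * m ^ 2)) : ℝ) : ℂ) *
          (((Real.exp (-(t * ‖ζ‖ ^ 2)) : ℝ) : ℂ) * fourierAt g ζ)) := by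
      intro ζ
      rw [subKernel, mul_add, neg_add, Real.exp_add]
      push_cast
      ring
    simp only [e]
    rw [integral_const_mul, integral_sub hi (hi2.const_mul _), integral_const_mul,
      integral_gaussian_mul_fourierAt hu ht, hu.integral_fourierAt hg0]
    simp only [hq]
    push_cast
    ring
  have hqpos : ∀ t ∈ Set.Ioi (0 : ℝ), 0 < q t := by
    intro t (ht : 0 < t)
    refine mul_pos (Real.rpow_pos_of_pos ht _) (mul_pos (Real.exp_pos _) ?_)
    obtain ⟨y₀, hy₀⟩ := Function.ne_iff.1 hne
    have hcont : Continuous fun y : E d =>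
        (Real.pi / t) ^ ((d : ℝ) / 2) * Real.exp (-(‖y‖ ^ 2 / (4 * t))) * u y := by fun_prop
    have hcs : HasCompactSupport u := by
      have := hu.2.comp_left (g := re) (by simp)
      exact this
    have hw : ∀ y : E d, 0 < (Real.pi / t) ^ ((d : ℝ) / 2) * Real.exp (-(‖y‖ ^ 2 / (4 * t))) :=
      fun y => mul_pos (Real.rpow_pos_of_pos (div_pos Real.pi_pos ht) _) (Real.exp_pos _)
    exact hcont.integral_pos_of_hasCompactSupport_nonneg_nonzero hcs.mul_left
      (fun y => mul_nonneg (hw y).le (hpos y)) (mul_ne_zero (hw y₀).ne' hy₀)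
  have hqi : IntegrableOn q (Set.Ioi 0) := by
    have h1 := hprod.integral_prod_right
    have h2 : IntegrableOn (fun t => ((-q t : ℝ) : ℂ)) (Set.Ioi 0) :=
      IntegrableOn.congr_fun h1 hright measurableSet_Ioi
    have h3 := (Integrable.re h2).neg
    refine Integrable.congr h3 (ae_of_all _ fun t => ?_)
    simp
  have hqint : 0 < ∫ t in Set.Ioi (0 : ℝ), q t := by
    rw [setIntegral_pos_iff_support_of_nonneg_ae
      ((ae_restrict_iff' measurableSet_Ioi).2 (ae_of_all _ fun t ht => (hqpos t ht).le)) hqi,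
      Set.inter_eq_right.2 (show Set.Ioi 0 ⊆ Function.support q from fun t ht => (hqpos t ht).ne')]
    simp
  intro hzero
  rw [hleft, hzero, mul_zero, setIntegral_congr_fun measurableSet_Ioi hright,
    integral_complex_ofReal, integral_neg] at hswap
  have : -∫ t in Set.Ioi (0 : ℝ), q t = 0 := by exact_mod_cast hswap.symm
  linarith

/-! ### Failure of gauge covariance with the midpoint potential -/

theorem gradient_eq_zero_of_notMem_tsupport {φ : 𝓢(E d, ℝ)} {z : E d} (hz : z ∉ tsupport φ) :
    gradient (fun z => φ z) z = 0 := by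
  have : fderiv ℝ φ z = 0 := image_eq_zero_of_notMem_tsupport fun h =>
    hz (tsupport_fderiv_subset ℝ h)
  rw [gradient, this, map_zero]

theorem cexp_neg_I_ne_one : cexp (-I) ≠ 1 := by
  intro h
  have h1 := congrArg re h
  rw [Complex.exp_re] at h1
  simp only [neg_re, I_re, neg_zero, Real.exp_zero, neg_im, I_im, one_mul, Real.cos_neg,
    one_re] at h1
  have := Real.cos_one_le
  linarith

/-- At $x=0$ the midpoint potential sees $\nabla\varphi$ only at $y/2$, where it vanishes for $y$ in
the support of $u$, whereas $e^{-i\varphi}=e^{-i}$ on that support. -/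
theorem exists_H1_gauge_ne (m : ℝ) (hd : 0 < d) {A : E d → E d} (hA : ContDiff ℝ ∞ A) :
    ∃ φ : 𝓢(E d, ℝ), ∃ f : E d → ℂ, IsTest f ∧
      H1 m (gauge A φ) f ≠ mulPhase φ (H1 m A (mulPhase (-φ) f)) := by
  set y₀ : E d := EuclideanSpace.single ⟨0, hd⟩ 1 with hy₀
  have hn : ‖y₀‖ = 1 := by simp [hy₀]
  -- For $|y-y_0|<1/4$ the midpoint $y/2$ is farther than $1/2-1/8=3/8>1/3$ from $y_0$, hence
  -- outside the support of $\varphi$; and $\varphi=1$ at $y$ itself.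
  let b : ContDiffBump y₀ := ⟨1 / 4, 1 / 3, by norm_num, by norm_num⟩
  let φ : 𝓢(E d, ℝ) := b.hasCompactSupport.toSchwartzMap b.contDiff
  let u : ContDiffBump y₀ := ⟨1 / 8, 1 / 4, by norm_num, by norm_num⟩
  have hφ : ∀ y, φ y = b y := fun y => rfl
  have hsupp : ∀ y, u y ≠ 0 → dist y y₀ < 1 / 4 := fun y hy => by
    have : y ∈ Function.support u := hy
    rwa [u.support_eq, Metric.mem_ball] at this
  have hu : IsTest fun y => ((u y : ℝ) : ℂ) :=
    ⟨ofRealCLM.contDiff.comp u.contDiff,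
      u.hasCompactSupport.comp_left (g := fun t : ℝ => (t : ℂ)) (by simp)⟩
  have hmid := contDiff_midA hA (0 : E d)
  -- The phase cancels the twist by $A$, so that both sides reduce to multiples of the nonnegative
  -- function $u$.
  let f : E d → ℂ := fun y =>
    cexp (I * ((⟪y, midA A 0 (0 + y)⟫_ℝ : ℝ) : ℂ)) * ((u y : ℝ) : ℂ)
  have hf : IsTest f := hu.mul_left ((contDiff_const.mul
    (ofRealCLM.contDiff.comp (contDiff_id.inner ℝ hmid))).cexp)
  have hφ0 : φ 0 = 0 := by
    rw [hφ]
    refine b.zero_of_le_dist ?_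
    rw [dist_zero_left, hn]
    norm_num
  have hφ1 : ∀ y, u y ≠ 0 → φ y = 1 := fun y hy =>
    b.one_of_mem_closedBall (Metric.mem_closedBall.2 (hsupp y hy).le)
  have hgrad : ∀ y, u y ≠ 0 → gradient (fun z => φ z) ((1 / 2 : ℝ) • (0 + (0 + y))) = 0 := by
    intro y hy
    refine gradient_eq_zero_of_notMem_tsupport fun hmem => ?_
    have h1 : dist ((1 / 2 : ℝ) • (0 + (0 + y))) y₀ ≤ 1 / 3 := by
      have : tsupport φ = Metric.closedBall y₀ b.rOut := b.tsupport_eq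
      rw [this] at hmem
      exact hmem
    have h2 := hsupp y hy
    rw [zero_add, zero_add, dist_eq_norm] at h1
    rw [dist_eq_norm] at h2
    have h3 : (1 / 2 : ℝ) • y₀ = (1 / 2 : ℝ) • (y - y₀) - ((1 / 2 : ℝ) • y - y₀) := by module
    have h4 := norm_sub_le ((1 / 2 : ℝ) • (y - y₀)) ((1 / 2 : ℝ) • y - y₀)
    rw [← h3, norm_smul, norm_smul, hn] at h4
    norm_num at h4
    linarith
  refine ⟨φ, f, hf, fun hEq => ?_⟩
  have hx := congrFun hEq 0
  rw [mulPhase, hφ0, ofReal_zero, mul_zero, Complex.exp_zero, one_mul, H1, H1,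
    pseudoDiff_eq m (contDiff_midA (contDiff_gauge hA φ) 0) hf,
    pseudoDiff_eq m hmid (hf.mulPhase (-φ))] at hx
  have hpi : (((2 * Real.pi) ^ d : ℝ) : ℂ)⁻¹ ≠ 0 := by
    refine inv_ne_zero ?_
    exact_mod_cast (by positivity : (2 * Real.pi) ^ d ≠ 0)
  have hx' := mul_left_cancel₀ hpi hx
  have e1 : twist (fun y => midA (gauge A φ) 0 (0 + y)) (fun y => f (0 + y)) =
      fun y => ((u y : ℝ) : ℂ) := by
    funext y
    simp only [twist, f, zero_add y]
    by_cases hy : u y = 0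
    · simp [hy]
    · rw [← mul_assoc, ← Complex.exp_add]
      have : midA (gauge A φ) 0 y = midA A 0 y := by
        have := hgrad y hy
        rw [zero_add y] at this
        simp only [midA, gauge, this, add_zero]
      rw [this]
      simp
  have e2 : twist (fun y => midA A 0 (0 + y)) (fun y => mulPhase (-φ) f (0 + y)) =
      fun y => cexp (-I) * ((u y : ℝ) : ℂ) := by
    funext y
    simp only [twist, mulPhase, f, zero_add y]
    by_cases hy : u y = 0
    · simp [hy]
    · have : (-φ) y = -1 := by rw [_root_.neg_apply, hφ1 y hy]
      rw [this, mul_left_comm, ← mul_assoc (cexp (-I * _)), ← Complex.exp_add]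
      simp
  rw [e1, e2, sqrtSymbolAtZero_const_mul] at hx'
  have hne := sqrtSymbolAtZero_ne_zero m hu
    (u.zero_of_le_dist (by rw [dist_zero_left, hn]; change (1 / 4 : ℝ) ≤ 1; norm_num))
    (fun y => u.nonneg) (fun h => by
      have h1 := u.one_of_mem_closedBall (Metric.mem_closedBall_self u.rIn_pos.le)
      rw [h] at h1
      simp at h1)
  exact cexp_neg_I_ne_one (mul_right_cancel₀ hne (by rw [one_mul]; exact hx'.symm))

end MagRel

end

open MagRel in
theorem proposition2p8 (d : ℕ) (m : ℝ) (hm : 0 ≤ m) :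
    -- the oscillatory integrals that define `H_A^{(1)} f` and `H_A^{(2)} f` exist
    (∀ A : E d → E d, IsTemperate A → ∀ f : E d → ℂ, IsTest f → ∀ x : E d,
      (∃ L, HasOscIntegral (amplitude m (midA A) f x) L) ∧
      (∃ L, HasOscIntegral (amplitude m (avgA A) f x) L)) ∧
    -- the nonnegative selfadjoint square root that defines `H_A^{(3)}` exists and is unique
    (∀ A : E d → E d, IsL2Loc A →
      ∃! S : L2 d →ₗ.[ℂ] L2 d, IsNonnegSqrt S (magGraph m A)) ∧
    -- gauge covariance of `H_A^{(2)}`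
    (∀ A : E d → E d, IsTemperate A → ∀ φ : SchwartzMap (E d) ℝ,
      ∀ f : E d → ℂ, IsTest f →
        H2 m (gauge A φ) f = mulPhase φ (H2 m A (mulPhase (-φ) f))) ∧
    -- gauge covariance of `H_A^{(3)}`
    (∀ A : E d → E d, IsL2Loc A → ∀ φ : SchwartzMap (E d) ℝ,
      H3 m (gauge A φ) = gaugeConj φ (H3 m A)) ∧
    -- failure of gauge covariance for `H_A^{(1)}`
    (0 < d → ∀ A : E d → E d, IsTemperate A → ∃ φ : SchwartzMap (E d) ℝ,
      ∃ f : E d → ℂ, IsTest f ∧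
        H1 m (gauge A φ) f ≠ mulPhase φ (H1 m A (mulPhase (-φ) f))) :=
  ⟨fun _ hA _ hf x =>
      ⟨⟨_, hasOscIntegral_amplitude m (contDiff_midA hA.1 x) hf⟩,
        ⟨_, hasOscIntegral_amplitude m (contDiff_avgA hA.1 x) hf⟩⟩,
    fun _ hA => existsUnique_isNonnegSqrt m hA,
    fun _ hA φ _ hf => H2_gauge m hA.1 φ hf,
    fun _ hA φ => H3_gauge m hA φ,
    fun hd _ hA => exists_H1_gauge_ne m hd hA.1⟩
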